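/- Let $k$ be a field and let $(\mathcal B,\mathbb E,\mathfrak s)$ be an extriangulated category in the sense of Nakaoka–Palu such that $\mathcal B$ is $k$-linear, Hom-finite and Krull–Schmidt, has enough projectives and enough injectives, and satisfies (WIC): if $g\circ f$ is an inflation, then so is $f$, and if $g\circ f$ is a deflation, then so is $g$. Subcategories are full and closed under isomorphisms, finite direct sums and direct summands. Put $\mathbb E^{1}=\mathbb E$ and $\mathbb E^{i+1}(X,Y)=\mathbb E(\Omega^{i}X,Y)$ for $i\ge 1$, where $\Omega^iX$ is an $i$-th syzygy of $X$. A subcategory $\mathcal S$ is *presilting* if $\mathbb E^i(\mathcal S,\mathcal S)=0$ for all $i\ge 1$. It is *silting* if moreover the whole category is the smallest thick subcategory $\mathsf{thick}\,\mathcal S$ containing $\mathcal S$, where a subcategory is thick if, whenever two of the terms of an $\mathbb E$-triangle $A\to B\to C\dashrightarrow$ belong to it, so does the third. For a subcategory $\mathcal C$ put $\mathcal C^{\perp}=\{X\mid \mathbb E^i(\mathcal C,X)=0\ \forall i>0\}$ and ${}^{\perp}\mathcal C=\{X\mid \mathbb E^i(X,\mathcal C)=0\ \forall i>0\}$. Let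 $\mathcal C^{\wedge}=\bigcup_{n\ge 0}\mathcal C^{\wedge}_n$ and $\mathcal C^{\vee}=\bigcup_{n\ge 0}\mathcal C^{\vee}_n$, where $\mathcal C^\wedge_0=\mathcal C^\vee_0=\mathcal C$, where $\mathcal C^\wedge_n$ consists of the $X$ with an $\mathbb E$-triangle $C'\to C\to X\dashrightarrow$, $C'\in\mathcal C^\wedge_{n-1}$, $C\in\mathcal C$, and where $\mathcal C^\vee_n$ consists of the $X$ with an $\mathbb E$-triangle $X\to C\to C'\dashrightarrow$, $C\in\mathcal C$, $C'\in\mathcal C^\vee_{n-1}$. A pair of subcategories $(\mathcal U,\mathcal V)$ is a *cotorsion pair* if $\mathbb E(\mathcal U,\mathcal V)=0$ and every $B\in\mathcal B$ admits $\mathbb E$-triangles $V_B\to U_B\to B\dashrightarrow$ and $B\to V^B\to U^B\dashrightarrow$ with $U_B,U^B\in\mathcal U$ and $V_B,V^B\in\mathcal V$. Let $\mathcal W\subseteq\mathcal B$ be a presilting subcategory such that $(\mathcal W^{\vee},\mathcal W^{\perp})$ and $({}^{\perp}\mathcal W,\mathcal W^{\wedge})$ are cotorsion pairs in $\mathcal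 B$, and let $\mathcal Z={}^{\perp}\mathcal W\cap\mathcal W^{\perp}$, with the structure induced from $\mathcal B$ (its $\mathbb E$-triangles are those of $\mathcal B$ with all terms in $\mathcal Z$). Let $\mathcal S\supseteq\mathcal W$ be a presilting subcategory of $\mathcal B$. Then $\mathcal S\subseteq\mathcal Z$, and $\mathcal Z$ is a Frobenius extriangulated category (enough projectives, enough injectives, and these coincide) whose subcategory of projective-injective objects is $\mathcal W$. Moreover: 1. $\mathcal S$ is silting in $\mathcal B$ if and only if $\mathcal S$ is silting in $\mathcal Z$. 2. $\mathcal S$ is silting in $\mathcal B$ if and only if $\mathcal S/[\mathcal W]$ is silting in the triangulated category $\mathcal Z/[\mathcal W]$. Here the morphisms of $\mathcal Z/[\mathcal W]$ are those of $\mathcal Z$ modulo those that factor through an object of $\mathcal W$. The suspension $A\langle1\rangle$ is given by a choice of an $\mathbb E$-triangle $A\to W_A\to A\langle 1\rangle\dashrightarrow$ in $\mathcal Z$ with $W_A\in\mathcal W$ for every $A\in\mathcal Z$. Such a choice exists and the claim holds for every choice. The distinguished triangles are, up to isomorphism, the triangles $A\xrightarrow{\bar f}B\xrightarrow{\bar g}C\xrightarrow{\bar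 h}A\langle1\rangle$ where $A\xrightarrow{f}B\xrightarrow{g}C\dashrightarrow$ is an $\mathbb E$-triangle in $\mathcal Z$ and $(1_A,m,h)$, for some $m$, is a morphism from it to the chosen $\mathbb E$-triangle of $A$. A subcategory $\mathcal T$ of $\mathcal Z/[\mathcal W]$ is silting if $\operatorname{Hom}(\mathcal T,\mathcal T\langle i\rangle)=0$ for all $i\ge1$ and the smallest subcategory that contains $\mathcal T$ and has the two-out-of-three property for distinguished triangles is all of $\mathcal Z/[\mathcal W]$. -/

import Mathlib

open CategoryTheory CategoryTheory.Limits Opposite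

namespace Extri

universe w v u

/-! ### Subcategories

A full subcategory is given by the property of objects that cuts it out. -/

section Subcategories

variable {C : Type u} [Category.{v} C] [Preadditive C]

/-- The standing convention on subcategories: full, closed under isomorphisms, under (finite)
direct sums, and under direct summands. -/
structure IsSubcat (P : ObjectProperty C) : Prop where
  of_iso : ∀ {A B : C}, (A ≅ B) → P A → P B
  zero : ∀ A : C, IsZero A → P A
  sum : ∀ {A B : C} (b : BinaryBicone A B), b.IsBilimit → P A → P B → P b.pt
  summand : ∀ {A B : C} (b : BinaryBicone A B), b.IsBilimit → P b.pt → P A ∧ P B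

/-- `P` is a thick subcategory with respect to a class `tri` of triples of objects
(the triples `(A, B, C)` that underlie an `𝔼`-triangle, or a distinguished triangle,
`A → B → C`): a subcategory with the two-out-of-three property. -/
structure IsThick (tri : C → C → C → Prop) (P : ObjectProperty C) : Prop extends IsSubcat P where
  left : ∀ {A B D : C}, tri A B D → P B → P D → P A
  middle : ∀ {A B D : C}, tri A B D → P A → P D → P B
  right : ∀ {A B D : C}, tri A B D → P A → P B → P D

/-- The smallest thick subcategory containing `S`. -/
def thick (tri : C → C → C → Prop) (S : ObjectProperty C) : ObjectProperty C :=
  fun A => ∀ P : ObjectProperty C, IsThick tri P → S ≤ P → P A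

/-- A Krull-Schmidt category: every object is a finite direct sum of objects with local
endomorphism rings. -/
def IsKrullSchmidt (C : Type u) [Category.{v} C] [Preadditive C] : Prop :=
  ∀ A : C, ∃ (n : ℕ) (Y : Fin n → C) (b : Bicone Y),
    Nonempty b.IsBilimit ∧ Nonempty (b.pt ≅ A) ∧ ∀ i, IsLocalRing (End (Y i))

end Subcategories

/-! ### Extriangulated categories (Nakaoka-Palu) -/

/-- The data of an extriangulated category: an additive bifunctor `𝔼 : Cᵒᵖ × C ⥤ Ab` and, for
every extension `δ ∈ 𝔼(D, A)`, a class `𝔰(δ)` of sequences `A → B → D`;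
`real x y δ` says that the sequence `(x, y)` belongs to `𝔰(δ)`, that is, that
`A --x--> B --y--> D --δ-->` is an `𝔼`-triangle. -/
structure ExtStruct (C : Type u) [Category.{v} C] [Preadditive C] where
  functor : Cᵒᵖ ⥤ C ⥤ AddCommGrpCat.{w}
  additive_left : functor.Additive
  additive_right : ∀ D : Cᵒᵖ, (functor.obj D).Additive
  real : ∀ {A B D : C}, (A ⟶ B) → (B ⟶ D) → ((functor.obj (op D)).obj A) → Prop

namespace ExtStruct

variable {C : Type u} [Category.{v} C] [Preadditive C] (X : ExtStruct.{w} C)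

/-- The group `𝔼(D, A)`. -/
abbrev E (D A : C) : Type w := (X.functor.obj (op D)).obj A

/-- `a_* : 𝔼(D, A) → 𝔼(D, A')`. -/
def push {D A A' : C} (a : A ⟶ A') : X.E D A →+ X.E D A' :=
  ((X.functor.obj (op D)).map a).hom

/-- `c^* : 𝔼(D, A) → 𝔼(D', A)`. -/
def pull {D D' A : C} (c : D' ⟶ D) : X.E D A →+ X.E D' A :=
  ((X.functor.map c.op).app A).hom

/-- The extension `δ ⊕ δ'`, for given direct sums of the end terms. -/
def sumExt {A A' D D' : C} (bA : BinaryBicone A A') (bD : BinaryBicone D D')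
    (δ : X.E D A) (δ' : X.E D' A') : X.E bD.pt bA.pt :=
  X.pull bD.fst (X.push bA.inl δ) + X.pull bD.snd (X.push bA.inr δ')

/-- The direct sum of two morphisms, for given direct sums of the sources and of the targets. -/
def _root_.Extri.sumHom {A A' B B' : C} (bA : BinaryBicone A A') (bB : BinaryBicone B B')
    (f : A ⟶ B) (f' : A' ⟶ B') : bA.pt ⟶ bB.pt :=
  bA.fst ≫ f ≫ bB.inl + bA.snd ≫ f' ≫ bB.inr

/-- The axioms of an extriangulated category. -/
structure IsExtriangulated : Prop where
  hasFiniteBiproducts : HasFiniteBiproducts C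
  /-- `𝔰(δ)` is non-empty ... -/
  exists_real : ∀ {A D : C} (δ : X.E D A), ∃ (B : C) (x : A ⟶ B) (y : B ⟶ D), X.real x y δ
  /-- ... and is exactly one equivalence class of sequences `A → B → D`, two sequences being
  equivalent if there is an isomorphism of middle terms compatible with the identities of the
  end terms. -/
  real_iff : ∀ {A B B' D : C} {δ : X.E D A} {x : A ⟶ B} {y : B ⟶ D} (x' : A ⟶ B') (y' : B' ⟶ D),
    X.real x y δ → (X.real x' y' δ ↔ ∃ b : B ≅ B', x ≫ b.hom = x' ∧ b.hom ≫ y' = y)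
  /-- `𝔰` is a realization: morphisms of extensions lift to morphisms of `𝔼`-triangles. -/
  lift : ∀ {A B D A' B' D' : C} {δ : X.E D A} {δ' : X.E D' A'}
    {x : A ⟶ B} {y : B ⟶ D} {x' : A' ⟶ B'} {y' : B' ⟶ D'},
    X.real x y δ → X.real x' y' δ' → ∀ (a : A ⟶ A') (c : D ⟶ D'),
      X.push a δ = X.pull c δ' → ∃ b : B ⟶ B', x ≫ b = a ≫ x' ∧ b ≫ y' = y ≫ c
  /-- The realization is additive: split sequences realize zero ... -/
  real_zero : ∀ {A D : C} (b : BinaryBicone A D), b.IsBilimit →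
    X.real b.inl b.snd (0 : X.E D A)
  /-- ... and direct sums of sequences realize direct sums of extensions. -/
  real_sum : ∀ {A B D A' B' D' : C} {δ : X.E D A} {δ' : X.E D' A'}
    {x : A ⟶ B} {y : B ⟶ D} {x' : A' ⟶ B'} {y' : B' ⟶ D'},
    X.real x y δ → X.real x' y' δ' →
    ∀ (bA : BinaryBicone A A') (bB : BinaryBicone B B') (bD : BinaryBicone D D'),
      bA.IsBilimit → bB.IsBilimit → bD.IsBilimit →
      X.real (sumHom bA bB x x') (sumHom bB bD y y') (X.sumExt bA bD δ δ')
  /-- (ET3) -/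
  et3 : ∀ {A B D A' B' D' : C} {δ : X.E D A} {δ' : X.E D' A'}
    {x : A ⟶ B} {y : B ⟶ D} {x' : A' ⟶ B'} {y' : B' ⟶ D'},
    X.real x y δ → X.real x' y' δ' → ∀ (a : A ⟶ A') (b : B ⟶ B'), x ≫ b = a ≫ x' →
      ∃ c : D ⟶ D', y ≫ c = b ≫ y' ∧ X.push a δ = X.pull c δ'
  /-- (ET3)ᵒᵖ -/
  et3_op : ∀ {A B D A' B' D' : C} {δ : X.E D A} {δ' : X.E D' A'}
    {x : A ⟶ B} {y : B ⟶ D} {x' : A' ⟶ B'} {y' : B' ⟶ D'},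
    X.real x y δ → X.real x' y' δ' → ∀ (b : B ⟶ B') (c : D ⟶ D'), y ≫ c = b ≫ y' →
      ∃ a : A ⟶ A', x ≫ b = a ≫ x' ∧ X.push a δ = X.pull c δ'
  /-- (ET4) -/
  et4 : ∀ {A B D M F : C} {δ : X.E D A} {δ' : X.E F B}
    {f : A ⟶ B} {f' : B ⟶ D} {g : B ⟶ M} {g' : M ⟶ F},
    X.real f f' δ → X.real g g' δ' →
      ∃ (N : C) (h' : M ⟶ N) (d : D ⟶ N) (e : N ⟶ F) (δ'' : X.E N A),
        f' ≫ d = g ≫ h' ∧ h' ≫ e = g' ∧ X.real (f ≫ g) h' δ'' ∧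
        X.real d e (X.push f' δ') ∧ X.pull d δ'' = δ ∧ X.push f δ'' = X.pull e δ'
  /-- (ET4)ᵒᵖ -/
  et4_op : ∀ {A B D M F : C} {δ : X.E B D} {δ' : X.E M F}
    {f' : D ⟶ A} {f : A ⟶ B} {g' : F ⟶ B} {g : B ⟶ M},
    X.real f' f δ → X.real g' g δ' →
      ∃ (N : C) (d : D ⟶ N) (e : N ⟶ F) (h' : N ⟶ A) (δ'' : X.E M N),
        d ≫ h' = f' ∧ e ≫ g' = h' ≫ f ∧ X.real h' (f ≫ g) δ'' ∧
        X.real d e (X.pull g' δ) ∧ X.push e δ'' = δ' ∧ X.push d δ = X.pull g δ''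

/-- `(A, B, D)` underlies an `𝔼`-triangle `A → B → D ⇢`. -/
def IsTri (A B D : C) : Prop :=
  ∃ (x : A ⟶ B) (y : B ⟶ D) (δ : X.E D A), X.real x y δ

def IsInflation {A B : C} (x : A ⟶ B) : Prop :=
  ∃ (D : C) (y : B ⟶ D) (δ : X.E D A), X.real x y δ

def IsDeflation {B D : C} (y : B ⟶ D) : Prop :=
  ∃ (A : C) (x : A ⟶ B) (δ : X.E D A), X.real x y δ

/-- Condition (WIC). -/
def WIC : Prop :=
  ∀ {A B D : C} (f : A ⟶ B) (g : B ⟶ D),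
    (X.IsInflation (f ≫ g) → X.IsInflation f) ∧ (X.IsDeflation (f ≫ g) → X.IsDeflation g)

/-- The projective objects. -/
def proj : ObjectProperty C := fun P =>
  ∀ {A B D : C} (x : A ⟶ B) (y : B ⟶ D) (δ : X.E D A), X.real x y δ →
    ∀ c : P ⟶ D, ∃ b : P ⟶ B, b ≫ y = c

/-- The injective objects. -/
def inj : ObjectProperty C := fun I =>
  ∀ {A B D : C} (x : A ⟶ B) (y : B ⟶ D) (δ : X.E D A), X.real x y δ →
    ∀ a : A ⟶ I, ∃ b : B ⟶ I, x ≫ b = a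

def EnoughProj : Prop := ∀ D : C, ∃ A P : C, X.proj P ∧ X.IsTri A P D

def EnoughInj : Prop := ∀ A : C, ∃ I D : C, X.inj I ∧ X.IsTri A I D

/-- Frobenius: enough projectives, enough injectives, and these are the same objects. -/
def IsFrobenius : Prop := X.EnoughProj ∧ X.EnoughInj ∧ X.proj = X.inj

/-- `X.IsSyzygy n A A'`: the object `A'` is an `n`-th syzygy `Ωⁿ A` of `A`. -/
def IsSyzygy : ℕ → C → C → Prop
  | 0, A, A' => A' = A
  | n + 1, A, A' => ∃ A₁ P : C, IsSyzygy n A A₁ ∧ X.proj P ∧ X.IsTri A' P A₁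

/-- `𝔼ⁿ⁺¹(A, B) = 0`, where `𝔼ⁿ⁺¹(A, B) = 𝔼(Ωⁿ A, B)`. In an extriangulated category with enough
projectives this does not depend on the choice of the syzygy `Ωⁿ A`. -/
def ExtZero (n : ℕ) (A B : C) : Prop :=
  ∀ A' : C, X.IsSyzygy n A A' → ∀ δ : X.E A' B, δ = 0

/-- `W^⊥`, the objects `A` with `𝔼ⁱ(W, A) = 0` for all `i > 0`. -/
def rightPerp (W : ObjectProperty C) : ObjectProperty C :=
  fun A => ∀ w : C, W w → ∀ n : ℕ, X.ExtZero n w A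

/-- `^⊥W`, the objects `A` with `𝔼ⁱ(A, W) = 0` for all `i > 0`. -/
def leftPerp (W : ObjectProperty C) : ObjectProperty C :=
  fun A => ∀ w : C, W w → ∀ n : ℕ, X.ExtZero n A w

/-- `Cone(P, Q)`. -/
def cone (P Q : ObjectProperty C) : ObjectProperty C :=
  fun A => ∃ p q : C, P p ∧ Q q ∧ X.IsTri p q A

/-- `CoCone(P, Q)`. -/
def cocone (P Q : ObjectProperty C) : ObjectProperty C :=
  fun A => ∃ p q : C, P p ∧ Q q ∧ X.IsTri A p q

/-- `P^∧_n`. -/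
def wedgeN (P : ObjectProperty C) : ℕ → ObjectProperty C
  | 0 => P
  | n + 1 => X.cone (wedgeN P n) P

/-- `P^∨_n`. -/
def veeN (P : ObjectProperty C) : ℕ → ObjectProperty C
  | 0 => P
  | n + 1 => X.cocone P (veeN P n)

/-- `P^∧`. -/
def wedge (P : ObjectProperty C) : ObjectProperty C := fun A => ∃ n, X.wedgeN P n A

/-- `P^∨`. -/
def vee (P : ObjectProperty C) : ObjectProperty C := fun A => ∃ n, X.veeN P n A

/-- (Complete) cotorsion pairs. -/
structure IsCotorsionPair (U V : ObjectProperty C) : Prop where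
  left : IsSubcat U
  right : IsSubcat V
  ext_zero : ∀ A B : C, U A → V B → ∀ δ : X.E A B, δ = 0
  cone_eq : ∀ A : C, X.cone V U A
  cocone_eq : ∀ A : C, X.cocone V U A

/-- Presilting subcategories. -/
structure IsPresilting (S : ObjectProperty C) : Prop where
  isSubcat : IsSubcat S
  ext_zero : ∀ A B : C, S A → S B → ∀ n : ℕ, X.ExtZero n A B

/-- Silting subcategories. -/
structure IsSilting (S : ObjectProperty C) : Prop extends X.IsPresilting S where
  thick_eq : ∀ A : C, thick X.IsTri S A

/-- Condition (CP). -/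
def CP (W : ObjectProperty C) : Prop :=
  X.IsCotorsionPair (X.vee W) (X.rightPerp W) ∧ X.IsCotorsionPair (X.leftPerp W) (X.wedge W)

/-- The subcategory `Z = ^⊥W ∩ W^⊥`. -/
def Z (W : ObjectProperty C) : ObjectProperty C :=
  fun A => X.leftPerp W A ∧ X.rightPerp W A

/-- The structure induced on a full subcategory: `𝔼` is restricted, and the `𝔼`-triangles are
those whose terms all lie in the subcategory. -/
def restrict (P : ObjectProperty C) : ExtStruct.{w} P.FullSubcategory where
  functor := P.ι.op ⋙ X.functor ⋙ (Functor.whiskeringLeft _ _ _).obj P.ι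
  additive_left :=
    { map_add := by
        intro A B f g
        have := X.additive_left
        ext D : 2
        have h : (f.unop + g.unop).hom.op = f.unop.hom.op + g.unop.hom.op := rfl
        simp [h, Functor.map_add] }
  additive_right := fun D =>
    { map_add := by
        intro A B f g
        have := X.additive_right (op D.unop.obj)
        have h : (f + g).hom = f.hom + g.hom := rfl
        simp [h] }
  real := fun x y δ => X.real x.hom y.hom δ

end ExtStruct

/-! ### The quotient by an ideal and its triangles -/

section Stable

variable {C : Type u} [Category.{v} C] [Preadditive C]

/-- The subgroup `[W](A, B)` generated by the morphisms that factor through an object of `W`. -/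
def ideal (W : ObjectProperty C) (A B : C) : AddSubgroup (A ⟶ B) :=
  AddSubgroup.closure {f | ∃ w : C, W w ∧ ∃ (p : A ⟶ w) (q : w ⟶ B), f = p ≫ q}

/-- When `W` is closed under direct sums, `[W](A, B)` consists of the morphisms that factor
through an object of `W`. -/
theorem mem_ideal_iff [HasFiniteBiproducts C] {W : ObjectProperty C} (hW : IsSubcat W) {A B : C}
    (f : A ⟶ B) : f ∈ ideal W A B ↔ ∃ w : C, W w ∧ ∃ (p : A ⟶ w) (q : w ⟶ B), f = p ≫ q := by
  have := HasBinaryBiproducts.of_hasBinaryProducts (C := C)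
  constructor
  · intro hf
    induction hf using AddSubgroup.closure_induction with
    | mem f hf => exact hf
    | zero =>
      obtain ⟨z, hz⟩ := HasZeroObject.zero (C := C)
      exact ⟨z, hW.zero z hz, 0, 0, by simp⟩
    | add f g _ _ hf hg =>
      obtain ⟨w, hw, p, q, rfl⟩ := hf
      obtain ⟨w', hw', p', q', rfl⟩ := hg
      exact ⟨w ⊞ w', hW.sum _ (BinaryBiproduct.isBilimit w w') hw hw',
        biprod.lift p p', biprod.desc q q', by simp⟩
    | neg f _ hf =>
      obtain ⟨w, hw, p, q, rfl⟩ := hf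
      exact ⟨w, hw, -p, q, by simp⟩
  · exact fun h => AddSubgroup.subset_closure h

theorem comp_mem_ideal {W : ObjectProperty C} {A B D : C} (f : A ⟶ B) {g : B ⟶ D}
    (hg : g ∈ ideal W B D) : f ≫ g ∈ ideal W A D := by
  induction hg using AddSubgroup.closure_induction with
  | mem g hg =>
    obtain ⟨w, hw, p, q, rfl⟩ := hg
    exact AddSubgroup.subset_closure ⟨w, hw, f ≫ p, q, by simp⟩
  | zero => simp
  | add g h _ _ hg hh => rw [Preadditive.comp_add]; exact add_mem hg hh
  | neg g _ hg => rw [Preadditive.comp_neg]; exact neg_mem hg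

theorem mem_ideal_comp {W : ObjectProperty C} {A B D : C} {f : A ⟶ B} (g : B ⟶ D)
    (hf : f ∈ ideal W A B) : f ≫ g ∈ ideal W A D := by
  induction hf using AddSubgroup.closure_induction with
  | mem f hf =>
    obtain ⟨w, hw, p, q, rfl⟩ := hf
    exact AddSubgroup.subset_closure ⟨w, hw, p, q ≫ g, by simp⟩
  | zero => simp
  | add f h _ _ hf hh => rw [Preadditive.add_comp]; exact add_mem hf hh
  | neg f _ hf => rw [Preadditive.neg_comp]; exact neg_mem hf

/-- Congruence modulo the ideal `[W]`. -/
def stableRel (W : ObjectProperty C) : HomRel C := fun A B f g => f - g ∈ ideal W A B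

instance stableRel_congruence (W : ObjectProperty C) : Congruence (stableRel W) where
  comp_left f _ _ h := by
    unfold stableRel at *
    rw [← Preadditive.comp_sub]; exact comp_mem_ideal f h
  comp_right g h := by
    unfold stableRel at *
    rw [← Preadditive.sub_comp]; exact mem_ideal_comp g h
  equivalence :=
    { refl := fun f => by simp [stableRel]
      symm := fun {f g} h => by
        unfold stableRel at *
        simpa using neg_mem h
      trans := fun {f g h} h₁ h₂ => by
        unfold stableRel at *
        simpa using add_mem h₁ h₂ }

/-- The category `C/[W]`: the objects of `C`, and the morphisms of `C` modulo `[W]`. -/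
abbrev Stable (W : ObjectProperty C) := CategoryTheory.Quotient (stableRel W)

instance stablePreadditive (W : ObjectProperty C) : Preadditive (Stable W) :=
  Quotient.preadditive (stableRel W) (fun _ _ f₁ f₂ g₁ g₂ hf hg => by
    unfold stableRel at *
    have h : f₁ + g₁ - (f₂ + g₂) = (f₁ - f₂) + (g₁ - g₂) := by abel
    rw [h]; exact add_mem hf hg)

/-- The quotient functor `C ⥤ C/[W]`. -/
abbrev stableFunctor (W : ObjectProperty C) : C ⥤ Stable W := Quotient.functor (stableRel W)

/-- The subcategory `S/[W]` of `C/[W]`: it has the same objects as `S`. -/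
def stableImage (W S : ObjectProperty C) : ObjectProperty (Stable W) := fun A => S A.as

/-- A choice, for every object `A`, of an `𝔼`-triangle `A → W_A → A⟨1⟩ ⇢` with `W_A ∈ W`. -/
structure Suspension (X : ExtStruct.{w} C) (W : ObjectProperty C) where
  hull : C → C
  hull_mem : ∀ A, W (hull A)
  obj : C → C
  ι : ∀ A, A ⟶ hull A
  π : ∀ A, hull A ⟶ obj A
  δ : ∀ A, X.E (obj A) A
  real : ∀ A, X.real (ι A) (π A) (δ A)

namespace Suspension

variable {X : ExtStruct.{w} C} {W : ObjectProperty C} (σ : Suspension X W)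

/-- `A⟨1⟩`, as an object of the quotient category. -/
def shift (A : Stable W) : Stable W := ⟨σ.obj A.as⟩

/-- `A⟨i⟩` for `i : ℕ`. -/
def shiftN (i : ℕ) (A : Stable W) : Stable W := σ.shift^[i] A

/-- The morphism `a'` is `a⟨1⟩ : A⟨1⟩ → D⟨1⟩`: representatives of `a` and `a'` are the end terms
of a morphism from the chosen `𝔼`-triangle of `A` to that of `D`. -/
def IsShiftHom {A D : Stable W} (a : A ⟶ D) (a' : σ.shift A ⟶ σ.shift D) : Prop :=
  ∃ (a₀ : A.as ⟶ D.as) (m : σ.hull A.as ⟶ σ.hull D.as) (a₁ : σ.obj A.as ⟶ σ.obj D.as),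
    (stableFunctor W).map a₀ = a ∧ (stableFunctor W).map a₁ = a' ∧
    σ.ι A.as ≫ m = a₀ ≫ σ.ι D.as ∧ m ≫ σ.π D.as = σ.π A.as ≫ a₁ ∧
    X.push a₀ (σ.δ A.as) = X.pull a₁ (σ.δ D.as)

/-- Standard triangles `A → B → D → A⟨1⟩`: the images of `f`, `g`, `h`, where
`A --f--> B --g--> D ⇢` is an `𝔼`-triangle and `h` is the last component of a morphism `(1, m, h)`
from it to the chosen `𝔼`-triangle `A → W_A → A⟨1⟩ ⇢`. -/
def IsStandard {A B D : Stable W} (f : A ⟶ B) (g : B ⟶ D) (h : D ⟶ σ.shift A) : Prop :=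
  ∃ (f₀ : A.as ⟶ B.as) (g₀ : B.as ⟶ D.as) (δ : X.E D.as A.as)
    (m : B.as ⟶ σ.hull A.as) (h₀ : D.as ⟶ σ.obj A.as),
    X.real f₀ g₀ δ ∧ f₀ ≫ m = σ.ι A.as ∧ m ≫ σ.π A.as = g₀ ≫ h₀ ∧ δ = X.pull h₀ (σ.δ A.as) ∧
    (stableFunctor W).map f₀ = f ∧ (stableFunctor W).map g₀ = g ∧ (stableFunctor W).map h₀ = h

/-- Distinguished triangles: those isomorphic to a standard triangle. -/
def IsDistinguished {A B D : Stable W} (f : A ⟶ B) (g : B ⟶ D) (h : D ⟶ σ.shift A) : Prop :=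
  ∃ (A' B' D' : Stable W) (f' : A' ⟶ B') (g' : B' ⟶ D') (h' : D' ⟶ σ.shift A')
    (a : A ≅ A') (b : B ≅ B') (d : D ≅ D') (a' : σ.shift A ⟶ σ.shift A'),
    σ.IsStandard f' g' h' ∧ σ.IsShiftHom a.hom a' ∧
    f ≫ b.hom = a.hom ≫ f' ∧ g ≫ d.hom = b.hom ≫ g' ∧ h ≫ a' = d.hom ≫ h'

/-- `(A, B, D)` underlies a distinguished triangle `A → B → D → A⟨1⟩`. -/
def IsTri (A B D : Stable W) : Prop :=
  ∃ (f : A ⟶ B) (g : B ⟶ D) (h : D ⟶ σ.shift A), σ.IsDistinguished f g h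

/-- Silting subcategories of the triangulated category `C/[W]`:
`Hom(S, S⟨i⟩) = 0` for all `i ≥ 1`, and `thick S` is everything. -/
structure IsSilting (S : ObjectProperty (Stable W)) : Prop where
  isSubcat : IsSubcat S
  hom_zero : ∀ A B : Stable W, S A → S B → ∀ i : ℕ, 1 ≤ i → ∀ f : A ⟶ σ.shiftN i B, f = 0
  thick_eq : ∀ A : Stable W, thick σ.IsTri S A

end Suspension

end Stable

end Extri

/-! For an object of `Z`, the approximation by the first cotorsion pair has middle term in W^∨ ∩ W^⊥
= W and first term again in `Z`; the second pair gives the dual triangle (`exists_isTri_left`,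
`exists_isTri_right`). Since 𝔼(W, Z) = 0 = 𝔼(Z, W), these triangles are the Frobenius structure.

Presilting objects over `W` lie in `Z`, so silting in the ambient category and in `Z` differ only in
generation. Every object A has a model M in `Z`, linked to A by triangles A → V → U and R → M → V
with U ∈ W^∨ and R ∈ W^∧. As U and R are built from `W`, a thick subcategory containing `W` and M
contains A; hence `Z` generates everything. Conversely, models behave like a functor to `Z/[W]`,
although only objects are tracked: a model is unique up to summands in `W` (`mem_of_isModel`), and a
triangle has a triangle of models (`exists_isModel_isTri`, two horseshoes). So the objects with a
model in a given thick subcategory of `Z` containing `W` form a thick subcategory of the ambient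
category (`isThick_hasModel`).

Passing to `Z/[W]` is formal for a Frobenius category: ⟨i⟩ is an i-th cosyzygy, so Hom into it is
controlled by higher extensions, and thick subcategories containing `W` are closed under stable
retracts (`isSilting_stableImage_iff`). Condition (WIC) enters through the splitting of retracts. -/

namespace Extri

universe w v u

/-! ### Direct sums with a zero object -/

section Bicones

variable {C : Type u} [Category.{v} C] [Preadditive C]

/-- The direct sum of `M` and a zero object. -/
def biconeRightZero (M : C) {O : C} (hO : IsZero O) : BinaryBicone M O where
  pt := M
  fst := 𝟙 M
  snd := 0
  inl := 𝟙 M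
  inr := 0
  inl_fst := by simp
  inl_snd := by simp
  inr_fst := by simp
  inr_snd := hO.eq_of_src _ _

/-- The direct sum of a zero object and `M`. -/
def biconeLeftZero {O : C} (hO : IsZero O) (M : C) : BinaryBicone O M where
  pt := M
  fst := 0
  snd := 𝟙 M
  inl := 0
  inr := 𝟙 M
  inl_fst := hO.eq_of_src _ _
  inl_snd := by simp
  inr_fst := by simp
  inr_snd := by simp

end Bicones

namespace ExtStruct

variable {C : Type u} [Category.{v} C] [Preadditive C] {X : ExtStruct.{w} C}

/-! ### The bifunctor -/

section Bifunctor

@[simp] lemma push_id {D A : C} (δ : X.E D A) : X.push (𝟙 A) δ = δ := by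
  simp [push]

lemma push_comp {D A A' A'' : C} (a : A ⟶ A') (a' : A' ⟶ A'') (δ : X.E D A) :
    X.push (a ≫ a') δ = X.push a' (X.push a δ) := by
  simp [push]

@[simp] lemma pull_id {D A : C} (δ : X.E D A) : X.pull (𝟙 D) δ = δ := by
  simp [pull]

lemma pull_comp {D D' D'' A : C} (c : D' ⟶ D) (c' : D'' ⟶ D') (δ : X.E D A) :
    X.pull (c' ≫ c) δ = X.pull c' (X.pull c δ) := by
  simp [pull]

lemma push_pull {D D' A A' : C} (a : A ⟶ A') (c : D' ⟶ D) (δ : X.E D A) :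
    X.push a (X.pull c δ) = X.pull c (X.push a δ) := by
  simp [push, pull]

lemma push_add_hom {D A A' : C} (a a' : A ⟶ A') (δ : X.E D A) :
    X.push (a + a') δ = X.push a δ + X.push a' δ := by
  have := X.additive_right (op D)
  simp [push, Functor.map_add]

lemma pull_add_hom {D D' A : C} (c c' : D' ⟶ D) (δ : X.E D A) :
    X.pull (c + c') δ = X.pull c δ + X.pull c' δ := by
  have := X.additive_left
  simp [pull, Functor.map_add]

@[simp] lemma push_zero_hom {D A A' : C} (δ : X.E D A) : X.push (0 : A ⟶ A') δ = 0 := by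
  simpa using push_add_hom (0 : A ⟶ A') 0 δ

@[simp] lemma pull_zero_hom {D D' A : C} (δ : X.E D A) : X.pull (0 : D' ⟶ D) δ = 0 := by
  have h := pull_add_hom (0 : D' ⟶ D) 0 δ
  simpa using h

end Bifunctor

/-! ### Long exact sequences -/

namespace IsExtriangulated

variable (hX : X.IsExtriangulated)
include hX

lemma hasZeroObject : HasZeroObject C := by
  have := hX.hasFiniteBiproducts
  infer_instance

lemma hasBinaryBiproducts : HasBinaryBiproducts C := by
  have := hX.hasFiniteBiproducts
  exact hasBinaryBiproducts_of_finite_biproducts C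

lemma real_id_zero (M : C) {O : C} (hO : IsZero O) : X.real (𝟙 M) (0 : M ⟶ O) (0 : X.E O M) :=
  hX.real_zero (biconeRightZero M hO)
    (isBinaryBilimitOfTotal _ (show 𝟙 M ≫ 𝟙 M + (0 : M ⟶ O) ≫ (0 : O ⟶ M) = 𝟙 M by simp))

lemma real_zero_id (M : C) {O : C} (hO : IsZero O) : X.real (0 : O ⟶ M) (𝟙 M) (0 : X.E M O) :=
  hX.real_zero (biconeLeftZero hO M)
    (isBinaryBilimitOfTotal _ (show (0 : M ⟶ O) ≫ (0 : O ⟶ M) + 𝟙 M ≫ 𝟙 M = 𝟙 M by simp))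

variable {A B D M : C} {x : A ⟶ B} {y : B ⟶ D} {δ : X.E D A}

lemma exists_zero : ∃ O : C, IsZero O :=
  have := hX.hasZeroObject
  HasZeroObject.zero

/-- `Hom(M, A) → Hom(M, B) → Hom(M, D)` is exact. -/
lemma hom_exact_middle (h : X.real x y δ) (f : M ⟶ B) (hf : f ≫ y = 0) :
    ∃ g : M ⟶ A, g ≫ x = f := by
  obtain ⟨O, hO⟩ := hX.exists_zero
  -- The condition `f ≫ y = 0` makes `f` part of a morphism from the split triangle M → M → 0; the
  -- missing component is the factorization. Comparison with this triangle or with 0 → M → M also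
  -- gives the next five statements.
  obtain ⟨a, ha, -⟩ := hX.et3_op (hX.real_id_zero M hO) h f 0 (by simp [hf])
  exact ⟨a, by simpa using ha.symm⟩

/-- `Hom(D, M) → Hom(B, M) → Hom(A, M)` is exact. -/
lemma hom_exact_middle' (h : X.real x y δ) (f : B ⟶ M) (hf : x ≫ f = 0) :
    ∃ g : D ⟶ M, y ≫ g = f := by
  obtain ⟨O, hO⟩ := hX.exists_zero
  obtain ⟨c, hc, -⟩ := hX.et3 h (hX.real_zero_id M hO) 0 f (by simp [hf])
  exact ⟨c, by simpa using hc⟩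

lemma comp_eq_zero (h : X.real x y δ) : x ≫ y = 0 := by
  obtain ⟨O, hO⟩ := hX.exists_zero
  obtain ⟨c, hc, -⟩ := hX.et3 (hX.real_id_zero A hO) h (𝟙 A) x rfl
  simpa using hc.symm

lemma push_self (h : X.real x y δ) : X.push x δ = 0 := by
  obtain ⟨O, hO⟩ := hX.exists_zero
  obtain ⟨c, -, hc⟩ := hX.et3 h (hX.real_id_zero B hO) x (𝟙 B) (by simp)
  simpa using hc

lemma pull_self (h : X.real x y δ) : X.pull y δ = 0 := by
  obtain ⟨O, hO⟩ := hX.exists_zero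
  obtain ⟨a, -, ha⟩ := hX.et3_op (hX.real_zero_id B hO) h (𝟙 B) y (by simp)
  simpa using ha.symm

/-- `Hom(M, B) → Hom(M, D) → 𝔼(M, A)` is exact. -/
lemma exists_lift (h : X.real x y δ) (c : M ⟶ D) (hc : X.pull c δ = 0) :
    ∃ f : M ⟶ B, f ≫ y = c := by
  obtain ⟨O, hO⟩ := hX.exists_zero
  obtain ⟨b, -, hb⟩ := hX.lift (hX.real_zero_id M hO) h 0 c (by simp [hc])
  exact ⟨b, by simpa using hb⟩

/-- `Hom(B, M) → Hom(A, M) → 𝔼(D, M)` is exact. -/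
lemma exists_extend (h : X.real x y δ) (a : A ⟶ M) (ha : X.push a δ = 0) :
    ∃ f : B ⟶ M, x ≫ f = a := by
  obtain ⟨O, hO⟩ := hX.exists_zero
  obtain ⟨b, hb, -⟩ := hX.lift h (hX.real_id_zero M hO) a 0 (by simp [ha])
  exact ⟨b, by simpa using hb⟩

/-- `Hom(M, D) → 𝔼(M, A) → 𝔼(M, B)` is exact. -/
lemma exists_pull_eq (h : X.real x y δ) (ε : X.E M A) (hε : X.push x ε = 0) :
    ∃ c : M ⟶ D, X.pull c δ = ε := by
  obtain ⟨N, p, q, hpq⟩ := hX.exists_real ε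
  -- Since `x_* ε = 0`, the map `x` extends over the middle term of a realization of `ε`, giving a
  -- morphism of triangles that is the identity on A; its end component is `c`.
  obtain ⟨f, hf⟩ := hX.exists_extend hpq x hε
  obtain ⟨c, -, hc⟩ := hX.et3 hpq h (𝟙 A) f (by simp [hf])
  exact ⟨c, by simpa using hc.symm⟩

/-- `Hom(A, M) → 𝔼(D, M) → 𝔼(B, M)` is exact. -/
lemma exists_push_eq (h : X.real x y δ) (ε : X.E D M) (hε : X.pull y ε = 0) :
    ∃ a : A ⟶ M, X.push a δ = ε := by
  obtain ⟨N, p, q, hpq⟩ := hX.exists_real ε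
  obtain ⟨f, hf⟩ := hX.exists_lift hpq y hε
  obtain ⟨a, -, ha⟩ := hX.et3_op h hpq f (𝟙 D) (by simp [hf])
  exact ⟨a, by simpa using ha⟩

lemma exists_section (h : X.real x y (0 : X.E D A)) : ∃ s : D ⟶ B, s ≫ y = 𝟙 D :=
  hX.exists_lift h (𝟙 D) (by simp)

lemma exists_retraction (h : X.real x y (0 : X.E D A)) : ∃ r : B ⟶ A, x ≫ r = 𝟙 A :=
  hX.exists_extend h (𝟙 A) (by simp)

/-- `𝔼(M, A) → 𝔼(M, B) → 𝔼(M, D)` is exact. -/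
lemma ext_exact_middle (h : X.real x y δ) (ε : X.E M B) (hε : X.push y ε = 0) :
    ∃ ε' : X.E M A, X.push x ε' = ε := by
  obtain ⟨N, g, g', hg⟩ := hX.exists_real ε
  -- The second column of the (ET4) diagram realizes `y_* ε = 0`, so it has a section `s`, and `s^*
  -- δ''` is the required preimage.
  obtain ⟨N', h', d, e, δ'', -, -, -, h2, -, h4⟩ := hX.et4 h hg
  rw [hε] at h2
  obtain ⟨s, hs⟩ := hX.exists_section h2
  refine ⟨X.pull s δ'', ?_⟩
  rw [push_pull, h4, ← pull_comp, hs, pull_id]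

/-- `𝔼(D, M) → 𝔼(B, M) → 𝔼(A, M)` is exact. -/
lemma ext_exact_middle' (h : X.real x y δ) (ε : X.E B M) (hε : X.pull x ε = 0) :
    ∃ ε' : X.E D M, X.pull y ε' = ε := by
  obtain ⟨N, f', f, hf⟩ := hX.exists_real ε
  obtain ⟨N', d, e, h', δ'', -, -, -, h2, -, h4⟩ := hX.et4_op hf h
  rw [hε] at h2
  obtain ⟨r, hr⟩ := hX.exists_retraction h2
  refine ⟨X.push r δ'', ?_⟩
  rw [← push_pull, ← h4, ← push_comp, hr, push_id]

/-! ### Isomorphisms of triangles -/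

/-- The middle component of a morphism of triangles with identity end components is invertible. -/
lemma isIso_of_id (h : X.real x y δ) (b : B ⟶ B) (hx : x ≫ b = x) (hy : b ≫ y = y) :
    IsIso b := by
  obtain ⟨s, hs⟩ := hX.hom_exact_middle' h (b - 𝟙 B) (by simp [hx])
  obtain ⟨r, hr⟩ := hX.hom_exact_middle h (b - 𝟙 B) (by simp [hy])
  -- `b - 1` factors both through `x` and through `y`, so its square passes through `x ≫ y = 0`;
  -- hence `2 - b` is the inverse of `b`.
  have ht : (b - 𝟙 B) ≫ (b - 𝟙 B) = 0 := by
    have e : (b - 𝟙 B) ≫ (b - 𝟙 B) = (r ≫ x) ≫ (y ≫ s) := by rw [hr, hs]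
    rw [e, Category.assoc, reassoc_of% (hX.comp_eq_zero h)]
    simp
  have h2 : b ≫ b = b + b - 𝟙 B := by
    simp only [Preadditive.sub_comp, Preadditive.comp_sub, Category.comp_id,
      Category.id_comp] at ht
    rw [sub_eq_zero, sub_eq_iff_eq_add] at ht
    rw [ht]; abel
  refine ⟨⟨𝟙 B + 𝟙 B - b, ?_, ?_⟩⟩ <;>
  · simp only [Preadditive.sub_comp, Preadditive.comp_sub, Preadditive.comp_add,
      Preadditive.add_comp, Category.comp_id, Category.id_comp, h2]
    abel

/-- The five lemma. -/
lemma isIso_middle {A' B' D' : C} {x' : A' ⟶ B'} {y' : B' ⟶ D'} {δ' : X.E D' A'}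
    (h : X.real x y δ) (h' : X.real x' y' δ') (a : A ≅ A') (c : D ≅ D') (b : B ⟶ B')
    (hδ : X.push a.hom δ = X.pull c.hom δ') (hx : x ≫ b = a.hom ≫ x')
    (hy : b ≫ y' = y ≫ c.hom) : IsIso b := by
  have hδ' : X.push a.inv δ' = X.pull c.inv δ := by
    have := congrArg (fun t => X.pull c.inv (X.push a.inv t)) hδ
    simp only [← push_comp, push_pull, ← pull_comp, Iso.hom_inv_id, Iso.inv_hom_id,
      push_id, pull_id] at this
    exact this.symm
  obtain ⟨b', hx', hy'⟩ := hX.lift h' h a.inv c.inv hδ'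
  have i1 : IsIso (b ≫ b') := hX.isIso_of_id h _
    (by rw [reassoc_of% hx, hx']; simp) (by rw [Category.assoc, hy', reassoc_of% hy]; simp)
  have i2 : IsIso (b' ≫ b) := hX.isIso_of_id h' _
    (by rw [reassoc_of% hx', hx]; simp) (by rw [Category.assoc, hy, reassoc_of% hy']; simp)
  have e1 : IsSplitMono b := ⟨⟨⟨b' ≫ inv (b ≫ b'), by
    rw [← Category.assoc]; exact IsIso.hom_inv_id _⟩⟩⟩
  have e2 : IsSplitEpi b := ⟨⟨⟨inv (b' ≫ b) ≫ b', by
    rw [Category.assoc]; exact IsIso.inv_hom_id _⟩⟩⟩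
  exact isIso_of_mono_of_isSplitEpi b

lemma real_of_iso_middle {B' : C} (h : X.real x y δ) (b : B ≅ B') :
    X.real (x ≫ b.hom) (b.inv ≫ y) δ :=
  (hX.real_iff _ _ h).2 ⟨b, rfl, by simp⟩

lemma real_of_iso_ends {A' D' : C} (h : X.real x y δ) (a : A ≅ A') (c : D ≅ D') :
    X.real (a.inv ≫ x) (y ≫ c.hom) (X.push a.hom (X.pull c.inv δ)) := by
  obtain ⟨N, p, q, hpq⟩ := hX.exists_real (X.push a.hom (X.pull c.inv δ))
  have e : X.push a.hom δ = X.pull c.hom (X.push a.hom (X.pull c.inv δ)) := by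
    rw [← push_pull, ← pull_comp]; simp
  obtain ⟨b, hb, hb'⟩ := hX.lift h hpq a.hom c.hom e
  have := hX.isIso_middle h hpq a c b e hb hb'
  refine (hX.real_iff _ _ hpq).2 ⟨(asIso b).symm, ?_, ?_⟩
  · simp [← Category.assoc, IsIso.comp_inv_eq, ← cancel_epi a.hom, hb]
  · simp [hb']

lemma isTri_of_iso {A' B' D' : C} (h : X.IsTri A B D) (a : A ≅ A') (b : B ≅ B') (c : D ≅ D') :
    X.IsTri A' B' D' := by
  obtain ⟨x, y, δ, h⟩ := h
  exact ⟨_, _, _, hX.real_of_iso_ends (hX.real_of_iso_middle h b) a c⟩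

lemma exists_iso_of_real {B' : C} {x' : A ⟶ B'} {y' : B' ⟶ D} (h : X.real x y δ)
    (h' : X.real x' y' δ) : Nonempty (B ≅ B') := by
  obtain ⟨b, -⟩ := (hX.real_iff _ _ h).1 h'
  exact ⟨b⟩

/-- The second term `M` of the realization of `v_* δ` sits in a triangle `B → M → U`, where
`A → B → D` realizes `δ` and `A → V → U` is a triangle that begins with `v`. -/
lemma exists_pushout {V U N : C} {v : A ⟶ V} {u : V ⟶ U} {α : X.E U A} {p : V ⟶ N} {q : N ⟶ D}
    (h : X.real x y δ) (hα : X.real v u α) (hN : X.real p q (X.push v δ)) : X.IsTri B N U := by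
  have := hX.hasBinaryBiproducts
  let b := BinaryBiproduct.bicone D U
  have hb : b.IsBilimit := BinaryBiproduct.isBilimit D U
  let c := BinaryBiproduct.bicone U D
  -- One extension of D ⊕ U by A restricts to `δ` on D and to `α` on U. (ET4)ᵒᵖ against the two
  -- split triangles on D ⊕ U presents its middle term as B → M → U and as V → M → D, up to
  -- isomorphism.
  obtain ⟨M, i, j, hM⟩ := hX.exists_real
    (X.pull (biprod.fst : D ⊞ U ⟶ D) δ + X.pull (biprod.snd : D ⊞ U ⟶ U) α)
  have hs1 : X.real (biprod.inl : D ⟶ D ⊞ U) (biprod.snd : D ⊞ U ⟶ U) (0 : X.E U D) :=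
    hX.real_zero b hb
  have hs2 : X.real (biprod.inr : U ⟶ D ⊞ U) (biprod.fst : D ⊞ U ⟶ D) (0 : X.E D U) := by
    refine hX.real_zero (A := U) (D := D) ⟨D ⊞ U, biprod.snd, biprod.fst, biprod.inr, biprod.inl,
      by simp, by simp, by simp, by simp⟩ (isBinaryBilimitOfTotal _ ?_)
    simp only
    rw [add_comm]; exact biprod.total
  obtain ⟨N₁, d₁, e₁, h₁, δ₁, -, -, r₁, r₁', -, -⟩ := hX.et4_op hM hs1
  obtain ⟨N₂, d₂, e₂, h₂, δ₂, -, -, r₂, r₂', -, k₂⟩ := hX.et4_op hM hs2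
  have E1 : X.pull (biprod.inl : D ⟶ D ⊞ U)
      (X.pull (biprod.fst : D ⊞ U ⟶ D) δ + X.pull (biprod.snd : D ⊞ U ⟶ U) α) = δ := by
    rw [map_add, ← pull_comp, ← pull_comp]; simp
  have E2 : X.pull (biprod.inr : U ⟶ D ⊞ U)
      (X.pull (biprod.fst : D ⊞ U ⟶ D) δ + X.pull (biprod.snd : D ⊞ U ⟶ U) α) = α := by
    rw [map_add, ← pull_comp, ← pull_comp]; simp
  rw [E1] at r₁'
  rw [E2] at r₂'
  -- Restricting along D → D ⊕ U identifies the class of V → M → D as `v_* δ`, so M is the given N.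
  have k : X.push d₂ δ = δ₂ := by
    have := congrArg (X.pull (biprod.inl : D ⟶ D ⊞ U)) k₂
    rw [← push_pull, E1, ← pull_comp] at this
    simpa using this
  obtain ⟨f₁⟩ := hX.exists_iso_of_real r₁' h
  obtain ⟨f₂, hf₂, -⟩ := (hX.real_iff _ _ r₂').1 hα
  have r₂'' := hX.real_of_iso_ends r₂ f₂ (Iso.refl D)
  rw [← k, Iso.refl_inv, pull_id, ← push_comp, hf₂] at r₂''
  obtain ⟨f₃⟩ := hX.exists_iso_of_real r₂'' hN
  exact hX.isTri_of_iso ⟨_, _, _, r₁⟩ f₁ f₃ (Iso.refl U)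

/-- The second term `N` of the realization of `l^* δ` sits in a triangle `R → N → B`, where
`A → B → D` realizes `δ` and `R → L → D` is a triangle that ends with `l`. -/
lemma exists_pullback {R L N : C} {r : R ⟶ L} {l : L ⟶ D} {α : X.E D R} {p : A ⟶ N} {q : N ⟶ L}
    (h : X.real x y δ) (hα : X.real r l α) (hN : X.real p q (X.pull l δ)) : X.IsTri R N B := by
  have := hX.hasBinaryBiproducts
  obtain ⟨M, i, j, hM⟩ := hX.exists_real
    (X.push (biprod.inl : A ⟶ A ⊞ R) δ + X.push (biprod.inr : R ⟶ A ⊞ R) α)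
  have hs1 : X.real (biprod.inl : A ⟶ A ⊞ R) (biprod.snd : A ⊞ R ⟶ R) (0 : X.E R A) :=
    hX.real_zero (BinaryBiproduct.bicone A R) (BinaryBiproduct.isBilimit A R)
  have hs2 : X.real (biprod.inr : R ⟶ A ⊞ R) (biprod.fst : A ⊞ R ⟶ A) (0 : X.E A R) := by
    refine hX.real_zero (A := R) (D := A) ⟨A ⊞ R, biprod.snd, biprod.fst, biprod.inr, biprod.inl,
      by simp, by simp, by simp, by simp⟩ (isBinaryBilimitOfTotal _ ?_)
    simp only
    rw [add_comm]; exact biprod.total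
  obtain ⟨N₁, h₁, d₁, e₁, δ₁, -, -, r₁, r₁', -, k₁⟩ := hX.et4 hs1 hM
  obtain ⟨N₂, h₂, d₂, e₂, δ₂, -, -, r₂, r₂', -, -⟩ := hX.et4 hs2 hM
  have E1 : X.push (biprod.fst : A ⊞ R ⟶ A)
      (X.push (biprod.inl : A ⟶ A ⊞ R) δ + X.push (biprod.inr : R ⟶ A ⊞ R) α) = δ := by
    rw [map_add, ← push_comp, ← push_comp]; simp
  have E2 : X.push (biprod.snd : A ⊞ R ⟶ R)
      (X.push (biprod.inl : A ⟶ A ⊞ R) δ + X.push (biprod.inr : R ⟶ A ⊞ R) α) = α := by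
    rw [map_add, ← push_comp, ← push_comp]; simp
  rw [E1] at r₂'
  rw [E2] at r₁'
  have k : δ₁ = X.pull e₁ δ := by
    have := congrArg (X.push (biprod.fst : A ⊞ R ⟶ A)) k₁
    rw [← push_comp, push_pull, E1] at this
    simpa using this
  obtain ⟨f₂⟩ := hX.exists_iso_of_real r₂' h
  obtain ⟨f₁, -, hf₁⟩ := (hX.real_iff _ _ r₁').1 hα
  have r₁'' := hX.real_of_iso_ends r₁ (Iso.refl A) f₁
  rw [k, Iso.refl_hom, push_id, ← pull_comp, ← hf₁, Iso.inv_hom_id_assoc] at r₁''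
  obtain ⟨f₃⟩ := hX.exists_iso_of_real r₁'' hN
  exact hX.isTri_of_iso ⟨_, _, _, r₂⟩ (Iso.refl R) f₃ f₂

end IsExtriangulated

end ExtStruct

namespace ExtStruct

variable {C : Type u} [Category.{v} C] [Preadditive C] {X : ExtStruct.{w} C}

/-! ### Orthogonality and dimension shifting -/

variable (X) in
/-- `𝔼(A, B) = 0`. -/
def Orth (A B : C) : Prop := ∀ δ : X.E A B, δ = 0

variable (X) in
/-- The object `A'` is an `n`-th cosyzygy of `A`. -/
def IsCosyzygy : ℕ → C → C → Prop
  | 0, A, A' => A' = A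
  | n + 1, A, A' => ∃ A₁ I : C, IsCosyzygy n A A₁ ∧ X.inj I ∧ X.IsTri A₁ I A'

/-- The recursion in `IsSyzygy` adds the last step of a resolution; dimension shifting needs to peel
off the first one. -/
lemma isSyzygy_succ_of_isTri {n : ℕ} {A A₁ A' P : C} (hP : X.proj P) (h : X.IsTri A₁ P A)
    (h' : X.IsSyzygy n A₁ A') : X.IsSyzygy (n + 1) A A' := by
  induction n generalizing A' with
  | zero => obtain rfl : A' = A₁ := h'; exact ⟨A, P, rfl, hP, h⟩
  | succ n ih =>
    obtain ⟨A₂, Q, h₂, hQ, ht⟩ := h'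
    exact ⟨A₂, Q, ih h₂, hQ, ht⟩

lemma isCosyzygy_succ_of_isTri {n : ℕ} {A A₁ A' I : C} (hI : X.inj I) (h : X.IsTri A I A₁)
    (h' : X.IsCosyzygy n A₁ A') : X.IsCosyzygy (n + 1) A A' := by
  induction n generalizing A' with
  | zero => obtain rfl : A' = A₁ := h'; exact ⟨A, I, rfl, hI, h⟩
  | succ n ih =>
    obtain ⟨A₂, Q, h₂, hQ, ht⟩ := h'
    exact ⟨A₂, Q, ih h₂, hQ, ht⟩

lemma ExtZero.of_isTri {n : ℕ} {A A₁ B P : C} (h : X.ExtZero (n + 1) A B) (hP : X.proj P)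
    (ht : X.IsTri A₁ P A) : X.ExtZero n A₁ B :=
  fun A' hA' => h A' (isSyzygy_succ_of_isTri hP ht hA')

lemma leftPerp_syzygy {T : ObjectProperty C} {A A₁ P : C} (hA : X.leftPerp T A) (hP : X.proj P)
    (ht : X.IsTri A₁ P A) : X.leftPerp T A₁ :=
  fun t ht' n => (hA t ht' (n + 1)).of_isTri hP ht

lemma leftPerp.orth {T : ObjectProperty C} {A t : C} (hA : X.leftPerp T A) (ht : T t) :
    X.Orth A t := hA t ht 0 A rfl

lemma rightPerp.orth {T : ObjectProperty C} {A t : C} (hA : X.rightPerp T A) (ht : T t) :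
    X.Orth t A := hA t ht 0 t rfl

namespace IsExtriangulated

variable (hX : X.IsExtriangulated)
include hX

lemma ext_eq_zero_of_section {A B D : C} {x : A ⟶ B} {y : B ⟶ D} {δ : X.E D A}
    (h : X.real x y δ) {s : D ⟶ B} (hs : s ≫ y = 𝟙 D) : δ = 0 := by
  rw [← pull_id δ, ← hs, pull_comp, hX.pull_self h, map_zero]

lemma ext_eq_zero_of_retraction {A B D : C} {x : A ⟶ B} {y : B ⟶ D} {δ : X.E D A}
    (h : X.real x y δ) {r : B ⟶ A} (hr : x ≫ r = 𝟙 A) : δ = 0 := by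
  rw [← push_id δ, ← hr, push_comp, hX.push_self h, map_zero]

lemma proj_iff {P : C} : X.proj P ↔ ∀ B, X.Orth P B := by
  constructor
  · intro hP B δ
    obtain ⟨N, x, y, h⟩ := hX.exists_real δ
    obtain ⟨s, hs⟩ := hP x y δ h (𝟙 P)
    exact hX.ext_eq_zero_of_section h hs
  · intro hP A B D x y δ h c
    exact hX.exists_lift h c (hP _ _)

lemma inj_iff {I : C} : X.inj I ↔ ∀ A, X.Orth A I := by
  constructor
  · intro hI A δ
    obtain ⟨N, x, y, h⟩ := hX.exists_real δ
    obtain ⟨s, hs⟩ := hI x y δ h (𝟙 I)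
    exact hX.ext_eq_zero_of_retraction h hs
  · intro hI A B D x y δ h c
    exact hX.exists_extend h c (hI _ _)

lemma orth_middle {A B D M : C} (h : X.IsTri A B D) (h₁ : X.Orth M A) (h₂ : X.Orth M D) :
    X.Orth M B := by
  obtain ⟨x, y, δ, h⟩ := h
  intro ε
  obtain ⟨ε', rfl⟩ := hX.ext_exact_middle h ε (h₂ _)
  rw [h₁ ε', map_zero]

lemma orth_middle' {A B D M : C} (h : X.IsTri A B D) (h₁ : X.Orth A M) (h₂ : X.Orth D M) :
    X.Orth B M := by
  obtain ⟨x, y, δ, h⟩ := h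
  intro ε
  obtain ⟨ε', rfl⟩ := hX.ext_exact_middle' h ε (h₁ _)
  rw [h₂ ε', map_zero]

/-- A class in 𝔼(A, B₁) comes from a map A₁ → B₁ because 𝔼(P, B₁) = 0. This map lifts to I because
𝔼(A₁, B) = 0, so the class is the image of one in 𝔼(A, I) = 0. -/
lemma orth_shift_right {A₁ P A B I B₁ : C} (hA : X.IsTri A₁ P A) (hB : X.IsTri B I B₁)
    (h₁ : X.Orth P B₁) (h₂ : X.Orth A₁ B) (h₃ : X.Orth A I) : X.Orth A B₁ := by
  obtain ⟨i, p, δ, hA⟩ := hA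
  obtain ⟨j, q, ε, hB⟩ := hB
  intro η
  obtain ⟨a, rfl⟩ := hX.exists_push_eq hA η (h₁ _)
  obtain ⟨f, rfl⟩ := hX.exists_lift hB a (h₂ _)
  rw [push_comp, h₃ (X.push f δ), map_zero]

lemma orth_shift_left {A₁ P A B I B₁ : C} (hA : X.IsTri A₁ P A) (hB : X.IsTri B I B₁)
    (h₁ : X.Orth A₁ I) (h₂ : X.Orth A B₁) (h₃ : X.Orth P B) : X.Orth A₁ B := by
  obtain ⟨i, p, δ, hA⟩ := hA
  obtain ⟨j, q, ε, hB⟩ := hB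
  intro η
  obtain ⟨c, rfl⟩ := hX.exists_pull_eq hB η (h₁ _)
  obtain ⟨f, rfl⟩ := hX.exists_extend hA c (h₂ _)
  rw [pull_comp, h₃ (X.pull f ε), map_zero]

/-- Balance of higher extensions: a syzygy on the left is traded for a cosyzygy on the right, one
step at a time. Together with its converse below, it moves all the shifting to the second variable.
-/
lemma orth_isCosyzygy_of_extZero (hP : X.EnoughProj) {n : ℕ} {A B B' : C}
    (h : X.ExtZero n A B) (hB : X.IsCosyzygy n B B') : X.Orth A B' := by
  induction n generalizing A B' with
  | zero => obtain rfl : B' = B := hB; exact h A rfl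
  | succ n ih =>
    obtain ⟨B₁, I, hB₁, hI, ht⟩ := hB
    obtain ⟨A₁, P, hPP, htA⟩ := hP A
    exact hX.orth_shift_right htA ht (hX.proj_iff.1 hPP _) (ih (h.of_isTri hPP htA) hB₁)
      (hX.inj_iff.1 hI _)

lemma extZero_of_orth_isCosyzygy (hI : X.EnoughInj) {n : ℕ} {A B : C}
    (h : ∀ B', X.IsCosyzygy n B B' → X.Orth A B') : X.ExtZero n A B := by
  induction n generalizing B with
  | zero => rintro A' (rfl : A' = A); exact h B rfl
  | succ n ih =>
    rintro A' ⟨A₁, P, hA₁, hP, ht⟩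
    obtain ⟨I, B₁, hII, htB⟩ := hI B
    exact hX.orth_shift_left ht htB (hX.inj_iff.1 hII _)
      (ih (fun B' hB' => h B' (isCosyzygy_succ_of_isTri hII htB hB')) A₁ hA₁)
      (hX.proj_iff.1 hP _)

/-- With A itself as first argument, the exact sequences of a triangle in that variable apply
directly. For `rightPerp` the definition already has this form. -/
lemma leftPerp_iff (hP : X.EnoughProj) (hI : X.EnoughInj) {T : ObjectProperty C} {A : C} :
    X.leftPerp T A ↔ ∀ t, T t → ∀ n t', X.IsCosyzygy n t t' → X.Orth A t' :=
  ⟨fun h t ht n _ ht' => hX.orth_isCosyzygy_of_extZero hP (h t ht n) ht',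
    fun h t ht n => hX.extZero_of_orth_isCosyzygy hI (h t ht n)⟩

lemma leftPerp_middle (hP : X.EnoughProj) (hI : X.EnoughInj) {T : ObjectProperty C} {A B D : C}
    (h : X.IsTri A B D) (hA : X.leftPerp T A) (hD : X.leftPerp T D) : X.leftPerp T B := by
  rw [hX.leftPerp_iff hP hI] at *
  exact fun t ht n t' ht' => hX.orth_middle' h (hA t ht n t' ht') (hD t ht n t' ht')

lemma leftPerp_left (hP : X.EnoughProj) (hI : X.EnoughInj) {T : ObjectProperty C} {A B D : C}
    (h : X.IsTri A B D) (hB : X.leftPerp T B) (hD : X.leftPerp T D) : X.leftPerp T A := by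
  rw [hX.leftPerp_iff hP hI] at *
  intro t ht n t' ht'
  obtain ⟨I, t₁, hII, htr⟩ := hI t'
  exact hX.orth_shift_left h htr (hX.inj_iff.1 hII _)
    (hD t ht (n + 1) t₁ ⟨t', I, ht', hII, htr⟩) (hB t ht n t' ht')

lemma rightPerp_middle {T : ObjectProperty C} {A B D : C}
    (h : X.IsTri A B D) (hA : X.rightPerp T A) (hD : X.rightPerp T D) : X.rightPerp T B :=
  fun t ht n t' ht' => hX.orth_middle h (hA t ht n t' ht') (hD t ht n t' ht')

lemma rightPerp_right (hP : X.EnoughProj) {T : ObjectProperty C} {A B D : C}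
    (h : X.IsTri A B D) (hA : X.rightPerp T A) (hB : X.rightPerp T B) : X.rightPerp T D := by
  intro t ht n t' ht'
  obtain ⟨t₁, P, hPP, htr⟩ := hP t'
  exact hX.orth_shift_right htr h (hX.proj_iff.1 hPP _)
    (hA t ht (n + 1) t₁ ⟨t', P, ht', hPP, htr⟩) (hB t ht n t' ht')

/-! ### Direct summands and retracts -/

lemma summand_of_split {P : ObjectProperty C} (hP : IsSubcat P) {A B D : C} {x : A ⟶ B}
    {y : B ⟶ D} (h : X.real x y (0 : X.E D A)) (hB : P B) : P A ∧ P D := by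
  have := hX.hasBinaryBiproducts
  obtain ⟨e⟩ := hX.exists_iso_of_real h
    (hX.real_zero (BinaryBiproduct.bicone A D) (BinaryBiproduct.isBilimit A D))
  exact hP.summand _ (BinaryBiproduct.isBilimit A D) (hP.of_iso e hB)

lemma isTri_id_zero (M : C) {O : C} (hO : IsZero O) : X.IsTri M M O :=
  ⟨_, _, _, hX.real_id_zero M hO⟩

lemma isTri_zero_id (M : C) {O : C} (hO : IsZero O) : X.IsTri O M M :=
  ⟨_, _, _, hX.real_zero_id M hO⟩

end IsExtriangulated

end ExtStruct

/-- Every retract of an object is a direct summand. -/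
def RetractsSplit (C : Type u) [Category.{v} C] [Preadditive C] : Prop :=
  ∀ {A B : C} (i : A ⟶ B) (r : B ⟶ A), i ≫ r = 𝟙 A →
    ∃ (D : C) (b : BinaryBicone A D), Nonempty b.IsBilimit ∧ Nonempty (B ≅ b.pt)

lemma IsSubcat.of_retract {C : Type u} [Category.{v} C] [Preadditive C] (hC : RetractsSplit C)
    {P : ObjectProperty C} (hP : IsSubcat P) {A B : C} {i : A ⟶ B} {r : B ⟶ A}
    (h : i ≫ r = 𝟙 A) (hB : P B) : P A := by
  obtain ⟨D, b, ⟨hb⟩, ⟨e⟩⟩ := hC i r h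
  exact (hP.summand b hb (hP.of_iso e hB)).1

namespace ExtStruct

variable {C : Type u} [Category.{v} C] [Preadditive C] {X : ExtStruct.{w} C}

/-- The identity `i ≫ r` is an inflation, so (WIC) makes `i` one; its triangle splits because `i`
has a retraction. -/
lemma IsExtriangulated.retractsSplit (hX : X.IsExtriangulated) (hWIC : X.WIC) :
    RetractsSplit C := by
  intro A B i r h
  have := hX.hasBinaryBiproducts
  obtain ⟨O, hO⟩ := hX.exists_zero
  obtain ⟨D, y, δ, hi⟩ := (hWIC i r).1 (h ▸ ⟨O, _, _, hX.real_id_zero A hO⟩)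
  obtain rfl := hX.ext_eq_zero_of_retraction hi h
  exact ⟨D, BinaryBiproduct.bicone A D, ⟨BinaryBiproduct.isBilimit A D⟩,
    hX.exists_iso_of_real hi (hX.real_zero (BinaryBiproduct.bicone A D)
      (BinaryBiproduct.isBilimit A D))⟩

/-! ### Cotorsion pairs -/

namespace IsCotorsionPair

variable {U V : ObjectProperty C} (h : X.IsCotorsionPair U V) (hX : X.IsExtriangulated)
include h hX

/-- If A is orthogonal to V, its approximation V_A → U_A → A splits, so A is a summand of U_A.
Closure of U under extensions follows. -/
lemma left_iff {A : C} : U A ↔ ∀ B, V B → X.Orth A B := by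
  refine ⟨fun hA B hB => h.ext_zero A B hA hB, fun hA => ?_⟩
  obtain ⟨p, q, hp, hq, x, y, δ, ht⟩ := h.cone_eq A
  obtain rfl := hA p hp δ
  exact (hX.summand_of_split h.left ht hq).2

lemma right_iff {B : C} : V B ↔ ∀ A, U A → X.Orth A B := by
  refine ⟨fun hB A hA => h.ext_zero A B hA hB, fun hB => ?_⟩
  obtain ⟨p, q, hp, hq, x, y, δ, ht⟩ := h.cocone_eq B
  obtain rfl := hB q hq δ
  exact (hX.summand_of_split h.right ht hp).1

lemma left_middle {A B D : C} (ht : X.IsTri A B D) (hA : U A) (hD : U D) : U B := by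
  rw [h.left_iff hX] at *
  exact fun M hM => hX.orth_middle' ht (hA M hM) (hD M hM)

lemma right_middle {A B D : C} (ht : X.IsTri A B D) (hA : V A) (hD : V D) : V B := by
  rw [h.right_iff hX] at *
  exact fun M hM => hX.orth_middle ht (hA M hM) (hD M hM)

end IsCotorsionPair

/-! ### The horseshoe lemmas -/

namespace IsExtriangulated

variable (hX : X.IsExtriangulated)
include hX

lemma isTri_comp {A B M D F : C} {f : A ⟶ B} {f' : B ⟶ D} {δ : X.E D A} {g : B ⟶ M} {g' : M ⟶ F}
    {δ' : X.E F B} (h : X.real f f' δ) (h' : X.real g g' δ') :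
    ∃ N, X.IsTri A M N ∧ X.IsTri D N F := by
  obtain ⟨N, _, _, _, _, -, -, h₁, h₂, -, -⟩ := hX.et4 h h'
  exact ⟨N, ⟨_, _, _, h₁⟩, ⟨_, _, _, h₂⟩⟩

lemma isTri_comp_op {A B M D F : C} {f' : D ⟶ A} {f : A ⟶ B} {δ : X.E B D} {g' : F ⟶ B}
    {g : B ⟶ M} {δ' : X.E M F} (h : X.real f' f δ) (h' : X.real g' g δ') :
    ∃ N, X.IsTri N A M ∧ X.IsTri D N F := by
  obtain ⟨N, _, _, _, _, -, -, h₁, h₂, -, -⟩ := hX.et4_op h h'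
  exact ⟨N, ⟨_, _, _, h₁⟩, ⟨_, _, _, h₂⟩⟩

/-- The hypothesis `hU` plays the role of 𝔼²(U₂, V₁) = 0: it extends the class `v₁_* δ` from D to
V₂. The extended class is realized by V, and (ET4) assembles U. -/
lemma horseshoe_right (hI : X.EnoughInj) {A B D V₁ U₁ V₂ U₂ : C}
    (h : X.IsTri A B D) (h₁ : X.IsTri A V₁ U₁) (h₂ : X.IsTri D V₂ U₂)
    (hU : ∀ I V', X.inj I → X.IsTri V₁ I V' → X.Orth U₂ V') :
    ∃ V U, X.IsTri V₁ V V₂ ∧ X.IsTri B V U ∧ X.IsTri U₁ U U₂ := by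
  obtain ⟨x, y, δ, h⟩ := h
  obtain ⟨v₁, u₁, α₁, h₁⟩ := h₁
  obtain ⟨v₂, u₂, α₂, h₂⟩ := h₂
  obtain ⟨I, V', hII, i, p, η, hV'⟩ := hI V₁
  -- An injective hull of V₁ turns the class into a map D → V', so that extending the class becomes
  -- extending a map.
  obtain ⟨c, hc⟩ := hX.exists_pull_eq hV' (X.push v₁ δ) (hX.inj_iff.1 hII _ _)
  obtain ⟨c', rfl⟩ := hX.exists_extend h₂ c (hU I V' hII ⟨_, _, _, hV'⟩ _)
  obtain ⟨V, j, q, hV⟩ := hX.exists_real (X.pull c' η)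
  obtain ⟨N, d, e, h', δ'', -, -, t₁, t₂, -, -⟩ := hX.et4_op hV h₂
  rw [← pull_comp, hc] at t₂
  obtain ⟨f, g, ε, ht⟩ := hX.exists_pushout h h₁ t₂
  obtain ⟨U, hU₁, hU₂⟩ := hX.isTri_comp ht t₁
  exact ⟨V, U, ⟨_, _, _, hV⟩, hU₁, hU₂⟩

lemma horseshoe_left (hP : X.EnoughProj) {A B D L₁ R₁ L₂ R₂ : C}
    (h : X.IsTri A B D) (h₁ : X.IsTri R₁ L₁ A) (h₂ : X.IsTri R₂ L₂ D)
    (hR : ∀ P L', X.proj P → X.IsTri L' P L₂ → X.Orth L' R₁) :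
    ∃ L R, X.IsTri L₁ L L₂ ∧ X.IsTri R L B ∧ X.IsTri R₁ R R₂ := by
  obtain ⟨x, y, δ, h⟩ := h
  obtain ⟨r₁, l₁, α₁, h₁⟩ := h₁
  obtain ⟨r₂, l₂, α₂, h₂⟩ := h₂
  obtain ⟨L', P, hPP, i, p, η, hL'⟩ := hP L₂
  obtain ⟨c, hc⟩ := hX.exists_push_eq hL' (X.pull l₂ δ) (hX.proj_iff.1 hPP _ _)
  obtain ⟨c', rfl⟩ := hX.exists_lift h₁ c (hR P L' hPP ⟨_, _, _, hL'⟩ _)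
  obtain ⟨L, j, q, hL⟩ := hX.exists_real (X.push c' η)
  obtain ⟨N, h', d, e, δ'', -, -, t₁, t₂, -, -⟩ := hX.et4 h₁ hL
  rw [← push_comp, hc] at t₂
  obtain ⟨f, g, ε, ht⟩ := hX.exists_pullback h h₂ t₂
  obtain ⟨R, hR₁, hR₂⟩ := hX.isTri_comp_op t₁ ht
  exact ⟨L, R, ⟨_, _, _, hL⟩, hR₁, hR₂⟩

end IsExtriangulated

end ExtStruct

/-! ### Direct sums and subcategories inside a full subcategory -/

section FullSubcategories

variable {C : Type u} [Category.{v} C] [Preadditive C] {P : ObjectProperty C}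

/-- The image in the ambient category of a bicone in a full subcategory. -/
@[simps]
def biconeHom {A B : P.FullSubcategory} (b : BinaryBicone A B) : BinaryBicone A.obj B.obj where
  pt := b.pt.obj
  fst := b.fst.hom
  snd := b.snd.hom
  inl := b.inl.hom
  inr := b.inr.hom
  inl_fst := congrArg (·.hom) b.inl_fst
  inl_snd := congrArg (·.hom) b.inl_snd
  inr_fst := congrArg (·.hom) b.inr_fst
  inr_snd := congrArg (·.hom) b.inr_snd

/-- A bicone in the ambient category of objects of a full subcategory, as a bicone there. -/
@[simps]
def biconeMk {A B : P.FullSubcategory} (b : BinaryBicone A.obj B.obj) (hb : P b.pt) :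
    BinaryBicone A B where
  pt := ⟨b.pt, hb⟩
  fst := P.homMk b.fst
  snd := P.homMk b.snd
  inl := P.homMk b.inl
  inr := P.homMk b.inr
  inl_fst := P.hom_ext b.inl_fst
  inl_snd := P.hom_ext b.inl_snd
  inr_fst := P.hom_ext b.inr_fst
  inr_snd := P.hom_ext b.inr_snd

lemma isBilimit_biconeHom {A B : P.FullSubcategory} {b : BinaryBicone A B} (hb : b.IsBilimit) :
    Nonempty (biconeHom b).IsBilimit :=
  ⟨isBinaryBilimitOfTotal _ (congrArg (·.hom) (IsBilimit.binary_total hb))⟩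

lemma isBilimit_biconeMk {A B : P.FullSubcategory} {b : BinaryBicone A.obj B.obj}
    (hb : b.IsBilimit) (h : P b.pt) : Nonempty (biconeMk b h).IsBilimit :=
  ⟨isBinaryBilimitOfTotal _ (P.hom_ext (IsBilimit.binary_total hb))⟩

lemma isZero_obj {A : P.FullSubcategory} (h : IsZero A) : IsZero A.obj := by
  rw [IsZero.iff_id_eq_zero] at *
  exact congrArg (·.hom) h

lemma isZero_mk {A : C} (h : IsZero A) (hA : P A) : IsZero (⟨A, hA⟩ : P.FullSubcategory) := by
  rw [IsZero.iff_id_eq_zero] at *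
  exact P.hom_ext h

lemma RetractsSplit.fullSubcategory (hC : RetractsSplit C) (hP : IsSubcat P) :
    RetractsSplit P.FullSubcategory := by
  intro A B i r h
  obtain ⟨D, b, ⟨hb⟩, ⟨e⟩⟩ := hC i.hom r.hom (congrArg (·.hom) h)
  have h' : P b.pt := hP.of_iso e B.property
  let D' : P.FullSubcategory := ⟨D, (hP.summand b hb h').2⟩
  exact ⟨D', biconeMk (B := D') b h', isBilimit_biconeMk (B := D') hb h', ⟨P.isoMk e⟩⟩

lemma IsSubcat.inverseImage_ι {S : ObjectProperty C} (hS : IsSubcat S) :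
    IsSubcat (S.inverseImage P.ι) where
  of_iso e h := hS.of_iso (P.ι.mapIso e) h
  zero A h := hS.zero A.obj (isZero_obj h)
  sum b hb hA hB := by
    obtain ⟨hb'⟩ := isBilimit_biconeHom hb
    exact hS.sum _ hb' hA hB
  summand b hb h := by
    obtain ⟨hb'⟩ := isBilimit_biconeHom hb
    exact hS.summand _ hb' h

/-- The objects of a subcategory of a full subcategory, as objects of the ambient category. -/
def ambient {P : ObjectProperty C} (Q : ObjectProperty P.FullSubcategory) : ObjectProperty C :=
  fun A => ∃ h : P A, Q ⟨A, h⟩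

lemma IsSubcat.ambient {Q : ObjectProperty P.FullSubcategory} (hP : IsSubcat P)
    (hQ : IsSubcat Q) : IsSubcat (ambient Q) where
  of_iso e h := ⟨hP.of_iso e h.1, hQ.of_iso (A := ⟨_, h.1⟩) (P.isoMk e) h.2⟩
  zero A h := ⟨hP.zero A h, hQ.zero _ (isZero_mk h _)⟩
  sum {A B} b hb hA hB := by
    obtain ⟨h⟩ := isBilimit_biconeMk (A := ⟨A, hA.1⟩) (B := ⟨B, hB.1⟩) hb (hP.sum b hb hA.1 hB.1)
    exact ⟨_, hQ.sum _ h hA.2 hB.2⟩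
  summand {A B} b hb h := by
    have h' := hP.summand b hb h.1
    obtain ⟨hb'⟩ := isBilimit_biconeMk (A := ⟨A, h'.1⟩) (B := ⟨B, h'.2⟩) hb h.1
    have := hQ.summand _ hb' h.2
    exact ⟨⟨_, this.1⟩, ⟨_, this.2⟩⟩

end FullSubcategories

/-! ### The induced structure on an extension-closed subcategory -/

namespace ExtStruct

variable {C : Type u} [Category.{v} C] [Preadditive C] {X : ExtStruct.{w} C}

/-- An extension-closed subcategory is extriangulated. -/
lemma IsExtriangulated.restrict (hX : X.IsExtriangulated) {P : ObjectProperty C}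
    (hP : IsSubcat P) (hext : ∀ {A B D : C}, X.IsTri A B D → P A → P D → P B) :
    (X.restrict P).IsExtriangulated where
  hasFiniteBiproducts := by
    have := hX.hasBinaryBiproducts
    have : HasZeroObject P.FullSubcategory := by
      obtain ⟨O, hO⟩ := hX.exists_zero
      exact ⟨⟨O, hP.zero O hO⟩, isZero_mk hO _⟩
    have : HasBinaryBiproducts P.FullSubcategory := ⟨fun A B => by
      have hb := BinaryBiproduct.isBilimit A.obj B.obj
      obtain ⟨h⟩ := isBilimit_biconeMk hb (hP.sum _ hb A.property B.property)
      exact HasBinaryBiproduct.mk ⟨_, h⟩⟩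
    have := hasFiniteProducts_of_has_binary_and_terminal (C := P.FullSubcategory)
    exact HasFiniteBiproducts.of_hasFiniteProducts
  exists_real {A D} δ := by
    obtain ⟨B, x, y, h⟩ := hX.exists_real (A := A.obj) (D := D.obj) δ
    exact ⟨⟨B, hext ⟨x, y, δ, h⟩ A.property D.property⟩, P.homMk x, P.homMk y, h⟩
  real_iff x' y' h := by
    refine (hX.real_iff x'.hom y'.hom h).trans ⟨?_, ?_⟩
    · rintro ⟨b, h₁, h₂⟩
      exact ⟨P.isoMk b, P.hom_ext h₁, P.hom_ext h₂⟩
    · rintro ⟨b, h₁, h₂⟩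
      exact ⟨P.ι.mapIso b, congrArg (·.hom) h₁, congrArg (·.hom) h₂⟩
  lift h h' a c e := by
    obtain ⟨b, h₁, h₂⟩ := hX.lift h h' a.hom c.hom e
    exact ⟨P.homMk b, P.hom_ext h₁, P.hom_ext h₂⟩
  real_zero b hb := by
    obtain ⟨hb'⟩ := isBilimit_biconeHom hb
    exact hX.real_zero (biconeHom b) hb'
  real_sum h h' bA bB bD hA hB hD := by
    obtain ⟨hA'⟩ := isBilimit_biconeHom hA
    obtain ⟨hB'⟩ := isBilimit_biconeHom hB
    obtain ⟨hD'⟩ := isBilimit_biconeHom hD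
    exact hX.real_sum h h' (biconeHom bA) (biconeHom bB) (biconeHom bD) hA' hB' hD'
  et3 h h' a b e := by
    obtain ⟨c, h₁, h₂⟩ := hX.et3 h h' a.hom b.hom (congrArg (·.hom) e)
    exact ⟨P.homMk c, P.hom_ext h₁, h₂⟩
  et3_op h h' b c e := by
    obtain ⟨a, h₁, h₂⟩ := hX.et3_op h h' b.hom c.hom (congrArg (·.hom) e)
    exact ⟨P.homMk a, P.hom_ext h₁, h₂⟩
  et4 {A B D M F} _ _ _ _ _ _ h h' := by
    obtain ⟨N, h', d, e, δ'', h₁, h₂, h₃, h₄, h₅, h₆⟩ := hX.et4 h h'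
    exact ⟨⟨N, hext ⟨_, _, _, h₄⟩ D.property F.property⟩, P.homMk h', P.homMk d, P.homMk e, δ'',
      P.hom_ext h₁, P.hom_ext h₂, h₃, h₄, h₅, h₆⟩
  et4_op {A B D M F} _ _ _ _ _ _ h h' := by
    obtain ⟨N, d, e, h', δ'', h₁, h₂, h₃, h₄, h₅, h₆⟩ := hX.et4_op h h'
    exact ⟨⟨N, hext ⟨_, _, _, h₄⟩ D.property F.property⟩, P.homMk d, P.homMk e, P.homMk h', δ'',
      P.hom_ext h₁, P.hom_ext h₂, h₃, h₄, h₅, h₆⟩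

lemma isTri_restrict_iff {P : ObjectProperty C} {A B D : P.FullSubcategory} :
    (X.restrict P).IsTri A B D ↔ X.IsTri A.obj B.obj D.obj :=
  ⟨fun ⟨x, y, δ, h⟩ => ⟨x.hom, y.hom, δ, h⟩, fun ⟨x, y, δ, h⟩ => ⟨P.homMk x, P.homMk y, δ, h⟩⟩

end ExtStruct

/-! ### The reduction datum and closure properties of `Z` -/

namespace ExtStruct

variable {C : Type u} [Category.{v} C] [Preadditive C] {X : ExtStruct.{w} C}

variable (X) in
/-- The standing assumptions on `W` for silting reduction. -/
structure IsReductionDatum (W : ObjectProperty C) : Prop where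
  isExtriangulated : X.IsExtriangulated
  enoughProj : X.EnoughProj
  enoughInj : X.EnoughInj
  retractsSplit : RetractsSplit C
  isPresilting : X.IsPresilting W
  cp : X.CP W

lemma le_Z {S W : ObjectProperty C} (hS : X.IsPresilting S) (hWS : W ≤ S) : S ≤ X.Z W :=
  fun A hA => ⟨fun w hw => hS.ext_zero A w hA (hWS w hw),
    fun w hw => hS.ext_zero w A (hWS w hw) hA⟩

lemma le_vee (W : ObjectProperty C) : W ≤ X.vee W := fun _ hA => ⟨0, hA⟩

lemma le_wedge (W : ObjectProperty C) : W ≤ X.wedge W := fun _ hA => ⟨0, hA⟩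

namespace IsReductionDatum

variable {W : ObjectProperty C} (h : X.IsReductionDatum W)
include h

lemma isSubcat_Z : IsSubcat (X.Z W) where
  of_iso e hA := ⟨h.cp.2.left.of_iso e hA.1, h.cp.1.right.of_iso e hA.2⟩
  zero A hA := ⟨h.cp.2.left.zero A hA, h.cp.1.right.zero A hA⟩
  sum b hb hA hB := ⟨h.cp.2.left.sum b hb hA.1 hB.1, h.cp.1.right.sum b hb hA.2 hB.2⟩
  summand b hb hA :=
    ⟨⟨(h.cp.2.left.summand b hb hA.1).1, (h.cp.1.right.summand b hb hA.2).1⟩,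
      ⟨(h.cp.2.left.summand b hb hA.1).2, (h.cp.1.right.summand b hb hA.2).2⟩⟩

lemma W_le_Z : W ≤ X.Z W := le_Z h.isPresilting le_rfl

lemma Z_middle {A B D : C} (ht : X.IsTri A B D) (hA : X.Z W A) (hD : X.Z W D) : X.Z W B :=
  ⟨h.isExtriangulated.leftPerp_middle h.enoughProj h.enoughInj ht hA.1 hD.1,
    h.isExtriangulated.rightPerp_middle ht hA.2 hD.2⟩

lemma wedge_le_rightPerp : X.wedge W ≤ X.rightPerp W := by
  rintro A ⟨n, hn⟩
  induction n generalizing A with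
  | zero => exact (h.W_le_Z A hn).2
  | succ n ih =>
    obtain ⟨p, q, hp, hq, ht⟩ := hn
    exact h.isExtriangulated.rightPerp_right h.enoughProj ht (ih p hp) (h.W_le_Z q hq).2

lemma exists_isTri_of_vee {A : C} (hA : X.vee W A) :
    ∃ w A', W w ∧ X.vee W A' ∧ X.IsTri A w A' := by
  obtain ⟨n, hn⟩ := hA
  cases n with
  | zero =>
    obtain ⟨O, hO⟩ := h.isExtriangulated.exists_zero
    exact ⟨A, O, hn, le_vee W O (h.isPresilting.isSubcat.zero O hO),
      h.isExtriangulated.isTri_id_zero A hO⟩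
  | succ n =>
    obtain ⟨p, q, hp, hq, ht⟩ := hn
    exact ⟨p, q, hp, ⟨n, hq⟩, ht⟩

lemma exists_isTri_of_wedge {A : C} (hA : X.wedge W A) :
    ∃ A' w, X.wedge W A' ∧ W w ∧ X.IsTri A' w A := by
  obtain ⟨n, hn⟩ := hA
  cases n with
  | zero =>
    obtain ⟨O, hO⟩ := h.isExtriangulated.exists_zero
    exact ⟨O, A, le_wedge W O (h.isPresilting.isSubcat.zero O hO), hn,
      h.isExtriangulated.isTri_zero_id A hO⟩
  | succ n =>
    obtain ⟨p, q, hp, hq, ht⟩ := hn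
    exact ⟨p, q, ⟨n, hp⟩, hq, ht⟩

lemma orth_vee {A B : C} (hA : X.vee W A) (hB : X.rightPerp W B) : X.Orth A B :=
  h.cp.1.ext_zero A B hA hB

lemma orth_wedge {A B : C} (hA : X.leftPerp W A) (hB : X.wedge W B) : X.Orth A B :=
  h.cp.2.ext_zero A B hA hB

/-- The first step A → w → A' of a `W`-coresolution splits, since 𝔼(W^∨, W^⊥) = 0. -/
lemma mem_of_vee {A : C} (hA : X.vee W A) (hA' : X.rightPerp W A) : W A := by
  obtain ⟨w, A', hw, hv, x, y, δ, ht⟩ := h.exists_isTri_of_vee hA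
  obtain rfl := h.orth_vee hv hA' δ
  exact (h.isExtriangulated.summand_of_split h.isPresilting.isSubcat ht hw).1

lemma mem_of_wedge {A : C} (hA : X.wedge W A) (hA' : X.leftPerp W A) : W A := by
  obtain ⟨A', w, hv, hw, x, y, δ, ht⟩ := h.exists_isTri_of_wedge hA
  obtain rfl := h.orth_wedge hA' hv δ
  exact (h.isExtriangulated.summand_of_split h.isPresilting.isSubcat ht hw).2

/-! ### The Frobenius structure of `Z` -/

/-- The middle term of the first pair's approximation is an extension of objects of W^⊥, so it lies
in W^∨ ∩ W^⊥ = W. The kernel term lies in ^⊥W because the other two terms do. -/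
lemma exists_isTri_left {A : C} (hA : X.Z W A) :
    ∃ A' w, X.Z W A' ∧ W w ∧ X.IsTri A' w A := by
  obtain ⟨V, U, hV, hU, ht⟩ := h.cp.1.cone_eq A
  have hw : W U := h.mem_of_vee hU (h.isExtriangulated.rightPerp_middle ht hV hA.2)
  exact ⟨V, U, ⟨h.isExtriangulated.leftPerp_left h.enoughProj h.enoughInj ht
    (h.W_le_Z U hw).1 hA.1, hV⟩, hw, ht⟩

lemma exists_isTri_right {A : C} (hA : X.Z W A) :
    ∃ w A', W w ∧ X.Z W A' ∧ X.IsTri A w A' := by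
  obtain ⟨V, U, hV, hU, ht⟩ := h.cp.2.cocone_eq A
  have hw : W V := h.mem_of_wedge hV
    (h.isExtriangulated.leftPerp_middle h.enoughProj h.enoughInj ht hA.1 hU)
  exact ⟨V, U, hw, ⟨hU, h.isExtriangulated.rightPerp_right h.enoughProj ht hA.2
    (h.W_le_Z V hw).2⟩, ht⟩

lemma isExtriangulated_Z : (X.restrict (X.Z W)).IsExtriangulated :=
  h.isExtriangulated.restrict h.isSubcat_Z h.Z_middle

/-- For a projective of `Z` the triangle ending at it with middle term in `W` splits; conversely
𝔼(W, Z) = 0. -/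
lemma proj_Z : (X.restrict (X.Z W)).proj = W.inverseImage (X.Z W).ι := by
  ext P
  rw [h.isExtriangulated_Z.proj_iff]
  refine ⟨fun hP => ?_, fun hP B => B.property.2.orth hP⟩
  obtain ⟨A', w, hA', hw, x, y, δ, ht⟩ := h.exists_isTri_left P.property
  obtain rfl : δ = 0 := hP ⟨A', hA'⟩ δ
  exact (h.isExtriangulated.summand_of_split h.isPresilting.isSubcat ht hw).2

lemma inj_Z : (X.restrict (X.Z W)).inj = W.inverseImage (X.Z W).ι := by
  ext P
  rw [h.isExtriangulated_Z.inj_iff]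
  refine ⟨fun hP => ?_, fun hP B => B.property.1.orth hP⟩
  obtain ⟨w, A', hw, hA', x, y, δ, ht⟩ := h.exists_isTri_right P.property
  obtain rfl : δ = 0 := hP ⟨A', hA'⟩ δ
  exact (h.isExtriangulated.summand_of_split h.isPresilting.isSubcat ht hw).1

lemma isFrobenius_Z : (X.restrict (X.Z W)).IsFrobenius := by
  refine ⟨fun A => ?_, fun A => ?_, h.proj_Z.trans h.inj_Z.symm⟩
  · obtain ⟨A', w, hA', hw, ht⟩ := h.exists_isTri_left A.property
    exact ⟨⟨A', hA'⟩, ⟨w, h.W_le_Z w hw⟩, (congrFun h.proj_Z ⟨w, _⟩).mpr hw, isTri_restrict_iff.2 ht⟩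
  · obtain ⟨w, A', hw, hA', ht⟩ := h.exists_isTri_right A.property
    exact ⟨⟨w, h.W_le_Z w hw⟩, ⟨A', hA'⟩, (congrFun h.inj_Z ⟨w, _⟩).mpr hw, isTri_restrict_iff.2 ht⟩

/-- Syzygies in `Z` are taken along objects of `W`, which need not be projective in the ambient
category. They stay in ^⊥S all the same, because W ⊆ S ⊆ ^⊥S. -/
lemma isPresilting_Z {S : ObjectProperty C} (hS : X.IsPresilting S) (hWS : W ≤ S) :
    (X.restrict (X.Z W)).IsPresilting (S.inverseImage (X.Z W).ι) where
  isSubcat := hS.isSubcat.inverseImage_ι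
  ext_zero A B hA hB n A' hA' := by
    have key : X.leftPerp S A'.obj := by
      induction n generalizing A' with
      | zero => obtain rfl : A' = A := hA'; exact fun s hs => hS.ext_zero _ s hA hs
      | succ n ih =>
        obtain ⟨A₁, P, hA₁, hP, ht⟩ := hA'
        rw [h.proj_Z] at hP
        exact h.isExtriangulated.leftPerp_left h.enoughProj h.enoughInj
          (isTri_restrict_iff.1 ht) (fun s hs => hS.ext_zero _ s (hWS _ hP) hs) (ih A₁ hA₁)
    exact key.orth hB

end IsReductionDatum

/-! ### Models in `Z` of arbitrary objects -/

variable (X) in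
/-- `M` is a model of `A` in `Z`: there are `𝔼`-triangles `A → V → U` and `R → M → V` with
`U ∈ W^∨`, `V ∈ W^⊥`, `R ∈ W^∧`, `M ∈ Z`. -/
def IsModel (W : ObjectProperty C) (A M : C) : Prop :=
  ∃ V U R : C, X.rightPerp W V ∧ X.vee W U ∧ X.wedge W R ∧ X.Z W M ∧
    X.IsTri A V U ∧ X.IsTri R M V

namespace IsReductionDatum

variable {W : ObjectProperty C} (h : X.IsReductionDatum W)
include h

lemma exists_isModel (A : C) : ∃ M, X.IsModel W A M := by
  obtain ⟨V, U, hV, hU, ht⟩ := h.cp.1.cocone_eq A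
  obtain ⟨R, M, hR, hM, ht'⟩ := h.cp.2.cone_eq V
  exact ⟨M, V, U, R, hV, hU, hR, ⟨hM, h.isExtriangulated.rightPerp_middle ht'
    (h.wedge_le_rightPerp R hR) hV⟩, ht, ht'⟩

lemma isModel_self {A : C} (hA : X.Z W A) : X.IsModel W A A := by
  obtain ⟨O, hO⟩ := h.isExtriangulated.exists_zero
  exact ⟨A, O, O, hA.2, h.cp.1.left.zero O hO, h.cp.2.right.zero O hO, hA,
    h.isExtriangulated.isTri_id_zero A hO, h.isExtriangulated.isTri_zero_id A hO⟩

/-- Any two models of an object are isomorphic up to direct summands in `W`. -/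
lemma mem_of_isModel {P : ObjectProperty C} (hP : IsSubcat P) (hWP : W ≤ P) {A M M' : C}
    (hM : X.IsModel W A M) (hM' : X.IsModel W A M') (hPM : P M) : P M' := by
  have hX := h.isExtriangulated
  have := hX.hasBinaryBiproducts
  obtain ⟨V, U, R, hV, hU, hR, hZ, ⟨v, u, α, t₁⟩, ⟨r, l, ρ, t₂⟩⟩ := hM
  obtain ⟨V', U', R', hV', hU', hR', hZ', ⟨v', u', α', t₁'⟩, ⟨r', l', ρ', t₂'⟩⟩ := hM'
  -- Comparison maps V ⇄ V' under A, then lifts M ⇄ M' of these; they are mutually inverse only up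
  -- to maps through `W`.
  obtain ⟨a, ha⟩ := hX.exists_extend t₁ v' (h.orth_vee hU hV' _)
  obtain ⟨b, hb⟩ := hX.exists_extend t₁' v (h.orth_vee hU' hV _)
  obtain ⟨a₁, ha₁⟩ := hX.exists_lift t₂' (l ≫ a) (h.orth_wedge hZ.1 hR' _)
  obtain ⟨b₁, hb₁⟩ := hX.exists_lift t₂ (l' ≫ b) (h.orth_wedge hZ'.1 hR _)
  -- The error on V' vanishes on A, so it factors through U', and then through the first `W`-term
  -- `w` of a coresolution of U'.
  obtain ⟨c, hc⟩ := hX.hom_exact_middle' t₁' (𝟙 V' - b ≫ a)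
    (by rw [Preadditive.comp_sub, reassoc_of% hb, ha]; simp)
  obtain ⟨w, U₁, hw, hU₁, i, j, ε, t₃⟩ := h.exists_isTri_of_vee hU'
  obtain ⟨d, hd⟩ := hX.exists_extend t₃ c (h.orth_vee hU₁ hV' _)
  obtain ⟨d₁, hd₁⟩ := hX.exists_lift t₂' d (h.orth_wedge (h.W_le_Z w hw).1 hR' _)
  -- With that error subtracted, the remaining one on M' dies in V', so it factors through R', and
  -- then through a `W`-object `w'` mapping onto R'. Hence M' is a retract of M ⊕ w ⊕ w'.
  obtain ⟨e, he⟩ := hX.hom_exact_middle t₂' (𝟙 M' - b₁ ≫ a₁ - l' ≫ u' ≫ i ≫ d₁) (by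
    simp only [Preadditive.sub_comp, Category.assoc, hd₁, ha₁, hd, hc, reassoc_of% hb₁,
      Preadditive.comp_sub, Category.id_comp, Category.comp_id]
    abel)
  obtain ⟨R₁, w', hR₁, hw', i', j', ε', t₄⟩ := h.exists_isTri_of_wedge hR'
  obtain ⟨f, hf⟩ := hX.exists_lift t₄ e (h.orth_wedge hZ'.1 hR₁ _)
  refine hP.of_retract h.retractsSplit (B := M ⊞ (w ⊞ w'))
    (i := biprod.lift b₁ (biprod.lift (l' ≫ u' ≫ i) f))
    (r := biprod.desc a₁ (biprod.desc d₁ (j' ≫ r'))) ?_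
    (hP.sum _ (BinaryBiproduct.isBilimit _ _) hPM
      (hP.sum _ (BinaryBiproduct.isBilimit _ _) (hWP w hw) (hWP w' hw')))
  simp only [biprod.lift_desc, reassoc_of% hf, he, Category.assoc]
  abel

lemma exists_isModel_isTri {A B D M N : C} (ht : X.IsTri A B D) (hM : X.IsModel W A M)
    (hN : X.IsModel W D N) : ∃ L, X.IsModel W B L ∧ X.IsTri M L N := by
  have hX := h.isExtriangulated
  obtain ⟨V₁, U₁, R₁, hV₁, hU₁, hR₁, hZ₁, t₁, s₁⟩ := hM
  obtain ⟨V₂, U₂, R₂, hV₂, hU₂, hR₂, hZ₂, t₂, s₂⟩ := hN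
  -- The cosyzygy V' of V₁ remains in W^⊥, hence is orthogonal to U₂ ∈ W^∨. In the second horseshoe
  -- the syzygy L' of an object of `Z` remains in ^⊥W, orthogonal to R₁ ∈ W^∧.
  obtain ⟨V, U, hV, hU, hUU⟩ := hX.horseshoe_right h.enoughInj ht t₁ t₂ (fun I V' hI hV' =>
    h.orth_vee hU₂ (hX.rightPerp_right h.enoughProj hV' hV₁ (fun _ _ _ _ _ =>
      hX.inj_iff.1 hI _)))
  obtain ⟨L, R, hL, hR, hRR⟩ := hX.horseshoe_left h.enoughProj hV s₁ s₂ (fun P L' hP hL' =>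
    h.orth_wedge (leftPerp_syzygy hZ₂.1 hP hL') hR₁)
  exact ⟨L, ⟨V, U, R, hX.rightPerp_middle hV hV₁ hV₂, h.cp.1.left_middle hX hUU hU₁ hU₂,
    h.cp.2.right_middle hX hRR hR₁ hR₂, h.Z_middle hL hZ₁ hZ₂, hU, hR⟩, hL⟩

lemma isModel_sum {A B M N : C} (hM : X.IsModel W A M) (hN : X.IsModel W B N)
    {b : BinaryBicone A B} (hb : b.IsBilimit) {c : BinaryBicone M N} (hc : c.IsBilimit) :
    X.IsModel W b.pt c.pt := by
  have hX := h.isExtriangulated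
  have := hX.hasBinaryBiproducts
  obtain ⟨V₁, U₁, R₁, hV₁, hU₁, hR₁, hZ₁, ⟨_, _, _, t₁⟩, ⟨_, _, _, s₁⟩⟩ := hM
  obtain ⟨V₂, U₂, R₂, hV₂, hU₂, hR₂, hZ₂, ⟨_, _, _, t₂⟩, ⟨_, _, _, s₂⟩⟩ := hN
  exact ⟨V₁ ⊞ V₂, U₁ ⊞ U₂, R₁ ⊞ R₂,
    h.cp.1.right.sum _ (BinaryBiproduct.isBilimit _ _) hV₁ hV₂,
    h.cp.1.left.sum _ (BinaryBiproduct.isBilimit _ _) hU₁ hU₂,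
    h.cp.2.right.sum _ (BinaryBiproduct.isBilimit _ _) hR₁ hR₂,
    h.isSubcat_Z.sum _ hc hZ₁ hZ₂,
    ⟨_, _, _, hX.real_sum t₁ t₂ b _ _ hb (BinaryBiproduct.isBilimit V₁ V₂)
      (BinaryBiproduct.isBilimit U₁ U₂)⟩,
    ⟨_, _, _, hX.real_sum s₁ s₂ _ c _ (BinaryBiproduct.isBilimit R₁ R₂) hc
      (BinaryBiproduct.isBilimit V₁ V₂)⟩⟩

lemma isModel_of_iso {A B M : C} (e : A ≅ B) (hM : X.IsModel W A M) : X.IsModel W B M := by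
  obtain ⟨V, U, R, hV, hU, hR, hZ, t, s⟩ := hM
  exact ⟨V, U, R, hV, hU, hR, hZ,
    h.isExtriangulated.isTri_of_iso t e (Iso.refl V) (Iso.refl U), s⟩

/-- The objects with a model in a thick subcategory of `Z` containing `W` form a thick
subcategory. -/
lemma isThick_hasModel {P : ObjectProperty C} (hP : IsSubcat P) (hWP : W ≤ P)
    (hleft : ∀ {A B D : C}, X.Z W A → X.IsTri A B D → P B → P D → P A)
    (hmiddle : ∀ {A B D : C}, X.Z W B → X.IsTri A B D → P A → P D → P B)
    (hright : ∀ {A B D : C}, X.Z W D → X.IsTri A B D → P A → P B → P D) :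
    IsThick X.IsTri (fun A => ∃ M, X.IsModel W A M ∧ P M) where
  of_iso := by
    rintro A B e ⟨M, hM, hPM⟩
    exact ⟨M, h.isModel_of_iso e hM, hPM⟩
  zero A hA := ⟨A, h.isModel_self (h.isSubcat_Z.zero A hA), hP.zero A hA⟩
  sum := by
    have := h.isExtriangulated.hasBinaryBiproducts
    rintro A B b hb ⟨M, hM, hPM⟩ ⟨N, hN, hPN⟩
    exact ⟨_, h.isModel_sum hM hN hb (BinaryBiproduct.isBilimit M N),
      hP.sum _ (BinaryBiproduct.isBilimit M N) hPM hPN⟩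
  summand := by
    have := h.isExtriangulated.hasBinaryBiproducts
    rintro A B b hb ⟨L, hL, hPL⟩
    obtain ⟨M, hM⟩ := h.exists_isModel A
    obtain ⟨N, hN⟩ := h.exists_isModel B
    have := hP.summand _ (BinaryBiproduct.isBilimit M N) (h.mem_of_isModel hP hWP hL
      (h.isModel_sum hM hN hb (BinaryBiproduct.isBilimit M N)) hPL)
    exact ⟨⟨M, hM, this.1⟩, ⟨N, hN, this.2⟩⟩
  left := by
    rintro A B D ht ⟨L, hL, hPL⟩ ⟨N, hN, hPN⟩
    obtain ⟨M, hM⟩ := h.exists_isModel A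
    -- The horseshoe produces its own model L' of B; uniqueness up to `W` carries membership over
    -- from the given L.
    obtain ⟨L', hL', ht'⟩ := h.exists_isModel_isTri ht hM hN
    obtain ⟨_, _, _, _, _, _, hZ, _, _⟩ := id hM
    exact ⟨M, hM, hleft hZ ht' (h.mem_of_isModel hP hWP hL hL' hPL) hPN⟩
  middle := by
    rintro A B D ht ⟨M, hM, hPM⟩ ⟨N, hN, hPN⟩
    obtain ⟨L, hL, ht'⟩ := h.exists_isModel_isTri ht hM hN
    obtain ⟨_, _, _, _, _, _, hZ, _, _⟩ := id hL
    exact ⟨L, hL, hmiddle hZ ht' hPM hPN⟩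
  right := by
    rintro A B D ht ⟨M, hM, hPM⟩ ⟨L, hL, hPL⟩
    obtain ⟨N, hN⟩ := h.exists_isModel D
    obtain ⟨L', hL', ht'⟩ := h.exists_isModel_isTri ht hM hN
    obtain ⟨_, _, _, _, _, _, hZ, _, _⟩ := id hN
    exact ⟨N, hN, hright hZ ht' hPM (h.mem_of_isModel hP hWP hL hL' hPL)⟩

/-- A presilting subcategory containing `W` is silting if and only if it is silting in `Z`. -/
theorem isSilting_iff {S : ObjectProperty C} (hS : X.IsPresilting S) (hWS : W ≤ S) :
    X.IsSilting S ↔ (X.restrict (X.Z W)).IsSilting (S.inverseImage (X.Z W).ι) := by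
  have hX := h.isExtriangulated
  constructor
  · refine fun hsil => ⟨h.isPresilting_Z hS hWS, fun A P hP hSP => ?_⟩
    have hsub := h.isSubcat_Z.ambient hP.toIsSubcat
    have hSA : S ≤ ambient P := fun B hB => ⟨le_Z hS hWS B hB, hSP _ hB⟩
    have hthick := h.isThick_hasModel hsub (hWS.trans hSA)
      (fun hA ht hB hD => ⟨hA, hP.left (A := ⟨_, hA⟩) (isTri_restrict_iff.2 ht) hB.2 hD.2⟩)
      (fun hB ht hA hD => ⟨hB, hP.middle (B := ⟨_, hB⟩) (isTri_restrict_iff.2 ht) hA.2 hD.2⟩)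
      (fun hD ht hA hB => ⟨hD, hP.right (D := ⟨_, hD⟩) (isTri_restrict_iff.2 ht) hA.2 hB.2⟩)
    obtain ⟨M, hM, hPM⟩ := hsil.thick_eq A.obj _ hthick
      (fun B hB => ⟨B, h.isModel_self (le_Z hS hWS B hB), hSA B hB⟩)
    exact (h.mem_of_isModel hsub (hWS.trans hSA) hM (h.isModel_self A.property) hPM).2
  · refine fun hsil => ⟨hS, fun A P hP hSP => ?_⟩
    have hZP : X.Z W ≤ P := fun B hB => hsil.thick_eq ⟨B, hB⟩ (P.inverseImage (X.Z W).ι)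
      { toIsSubcat := hP.toIsSubcat.inverseImage_ι
        left := fun ht => hP.left (isTri_restrict_iff.1 ht)
        middle := fun ht => hP.middle (isTri_restrict_iff.1 ht)
        right := fun ht => hP.right (isTri_restrict_iff.1 ht) } (fun B hB => hSP _ hB)
    have hWP : W ≤ P := hWS.trans hSP
    have hvee : X.vee W ≤ P := by
      rintro B ⟨n, hn⟩
      induction n generalizing B with
      | zero => exact hWP B hn
      | succ n ih =>
        obtain ⟨p, q, hp, hq, ht⟩ := hn
        exact hP.left ht (hWP p hp) (ih q hq)
    have hwedge : X.wedge W ≤ P := by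
      rintro B ⟨n, hn⟩
      induction n generalizing B with
      | zero => exact hWP B hn
      | succ n ih =>
        obtain ⟨p, q, hp, hq, ht⟩ := hn
        exact hP.right ht (ih p hp) (hWP q hq)
    -- A is recovered from its model: R and M give V, then V and U give A.
    obtain ⟨M, V, U, R, -, hU, hR, hZ, t, s⟩ := h.exists_isModel A
    exact hP.left t (hP.right s (hwedge R hR) (hZP M hZ)) (hvee U hU)

end IsReductionDatum

end ExtStruct

/-! ### Subcategories of the stable category -/

section Stable

variable {C : Type u} [Category.{v} C] [Preadditive C] {W : ObjectProperty C}

lemma stableFunctor_map_eq_iff {A B : C} {f g : A ⟶ B} :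
    (stableFunctor W).map f = (stableFunctor W).map g ↔ f - g ∈ ideal W A B :=
  Quotient.functor_map_eq_iff (stableRel W) f g

lemma stableFunctor_map_eq_zero {A B : C} {f : A ⟶ B} (hf : f ∈ ideal W A B) :
    (stableFunctor W).map f = 0 :=
  stableFunctor_map_eq_iff (g := 0).2 (by simpa using hf)

instance : (stableFunctor W).Additive where
  map_add := rfl

/-- A subcategory that contains `W` is closed under stable retracts. -/
lemma IsSubcat.of_stable_retract [HasFiniteBiproducts C] (hC : RetractsSplit C)
    {S : ObjectProperty C} (hS : IsSubcat S) (hW : IsSubcat W) (hWS : W ≤ S) {A B : Stable W}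
    {i : A ⟶ B} {r : B ⟶ A} (h : i ≫ r = 𝟙 A) (hB : S B.as) : S A.as := by
  have := hasBinaryBiproducts_of_finite_biproducts C
  obtain ⟨i, rfl⟩ := (stableFunctor W).map_surjective (X := A.as) (Y := B.as) i
  obtain ⟨r, rfl⟩ := (stableFunctor W).map_surjective (X := B.as) (Y := A.as) r
  have h' : 𝟙 A.as - i ≫ r ∈ ideal W A.as A.as :=
    stableFunctor_map_eq_iff.1 (by rw [Functor.map_comp, h]; exact ((stableFunctor W).map_id _))
  -- The failure of `i ≫ r` to be the identity factors through `w`, so A is an honest retract of B ⊕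
  -- w.
  obtain ⟨w, hw, p, q, hpq⟩ := (mem_ideal_iff hW _).1 h'
  refine hS.of_retract hC (i := biprod.lift i p) (r := biprod.desc r q) ?_
    (hS.sum _ (BinaryBiproduct.isBilimit B.as w) hB (hWS w hw))
  rw [biprod.lift_desc, ← hpq]
  abel

/-- Every closure property reduces to stable retracts. In particular, a direct sum in the stable
category is a stable retract of the direct sum formed in `C`. -/
lemma IsSubcat.stableImage [HasFiniteBiproducts C] (hC : RetractsSplit C)
    {S : ObjectProperty C} (hS : IsSubcat S) (hW : IsSubcat W) (hWS : W ≤ S) :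
    IsSubcat (stableImage W S) where
  of_iso e hA := hS.of_stable_retract hC hW hWS e.inv_hom_id hA
  zero A hA := by
    obtain ⟨O, hO⟩ := HasZeroObject.zero (C := C)
    exact hS.of_stable_retract hC hW hWS (B := ⟨O⟩) (i := 0) (r := 0)
      (hA.eq_of_src _ _) (hS.zero O hO)
  sum {A B} b hb hA hB := by
    have := hasBinaryBiproducts_of_finite_biproducts C
    let F := stableFunctor W
    let s : A.as ⟶ A.as ⊞ B.as := biprod.inl
    let t : B.as ⟶ A.as ⊞ B.as := biprod.inr
    let s' : A.as ⊞ B.as ⟶ A.as := biprod.fst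
    let t' : A.as ⊞ B.as ⟶ B.as := biprod.snd
    have e₁ : F.map s ≫ F.map s' = 𝟙 A := by
      rw [← F.map_comp, biprod.inl_fst]; exact F.map_id _
    have e₂ : F.map t ≫ F.map t' = 𝟙 B := by
      rw [← F.map_comp, biprod.inr_snd]; exact F.map_id _
    have e₃ : F.map s ≫ F.map t' = 0 := by
      rw [← F.map_comp, biprod.inl_snd]; exact F.map_zero _ _
    have e₄ : F.map t ≫ F.map s' = 0 := by
      rw [← F.map_comp, biprod.inr_fst]; exact F.map_zero _ _
    refine hS.of_stable_retract hC hW hWS (B := F.obj (A.as ⊞ B.as))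
      (i := b.fst ≫ F.map s + b.snd ≫ F.map t)
      (r := F.map s' ≫ b.inl + F.map t' ≫ b.inr) ?_
      (hS.sum _ (BinaryBiproduct.isBilimit A.as B.as) hA hB)
    simp only [Preadditive.add_comp, Preadditive.comp_add, Category.assoc, reassoc_of% e₁,
      reassoc_of% e₂, reassoc_of% e₃, reassoc_of% e₄, zero_comp, comp_zero, add_zero, zero_add]
    have total := IsBilimit.binary_total hb
    rw [← Category.id_comp b.inl, ← Category.id_comp b.inr] at total
    exact total
  summand b _ h :=
    ⟨hS.of_stable_retract hC hW hWS b.inl_fst h, hS.of_stable_retract hC hW hWS b.inr_snd h⟩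

/-- The stable functor preserves direct sums. -/
def isBilimit_map_stableFunctor {A B : C} {b : BinaryBicone A B} (hb : b.IsBilimit) :
    ((stableFunctor W).mapBinaryBicone b).IsBilimit :=
  isBinaryBilimitOfTotal _ (congrArg (stableFunctor W).map (IsBilimit.binary_total hb))

/-- The preimage in `C` of a subcategory of the stable category. -/
lemma IsSubcat.inverseImage_stableFunctor {P : ObjectProperty (Stable W)} (hP : IsSubcat P) :
    IsSubcat (P.inverseImage (stableFunctor W)) where
  of_iso e h := hP.of_iso ((stableFunctor W).mapIso e) h
  zero _ h := hP.zero _ ((stableFunctor W).map_isZero h)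
  sum _ hb hA hB := hP.sum _ (isBilimit_map_stableFunctor hb) hA hB
  summand _ hb h := hP.summand _ (isBilimit_map_stableFunctor hb) h

end Stable

/-! ### Silting in a Frobenius category and in its stable category -/

namespace ExtStruct

variable {C : Type u} [Category.{v} C] [Preadditive C] {X : ExtStruct.{w} C}
  {W : ObjectProperty C}

lemma nonempty_suspension (h : ∀ A : C, ∃ I D, W I ∧ X.IsTri A I D) :
    Nonempty (Suspension X W) := by
  choose I D hI ι π δ hr using h
  exact ⟨⟨I, hI, D, ι, π, δ, hr⟩⟩

/-- In a Frobenius extriangulated category, a presilting subcategory that contains the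
projective-injective objects is silting if and only if its stable image is. -/
theorem isSilting_stableImage_iff (hX : X.IsExtriangulated) (hF : X.IsFrobenius)
    (hC : RetractsSplit C) (hproj : X.proj = W) (hW : IsSubcat W) {S : ObjectProperty C}
    (hS : X.IsPresilting S) (hWS : W ≤ S) (σ : Suspension X W) :
    X.IsSilting S ↔ σ.IsSilting (stableImage W S) := by
  have := hX.hasFiniteBiproducts
  have hinj : X.inj = W := hF.2.2.symm.trans hproj
  have hWi : W ≤ X.inj := hinj.ge
  have hWp : W ≤ X.proj := hproj.ge
  have hcosyz : ∀ (i : ℕ) (B : Stable W), X.IsCosyzygy i B.as (σ.shiftN i B).as := by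
    intro i B
    induction i with
    | zero => rfl
    | succ i ih =>
      rw [Suspension.shiftN, Function.iterate_succ_apply']
      exact ⟨_, _, ih, hWi _ (σ.hull_mem _), ⟨_, _, _, σ.real _⟩⟩
  constructor
  · refine fun hsil => ⟨hS.isSubcat.stableImage hC hW hWS, ?_, fun A P hP hSP => ?_⟩
    · rintro A B hA hB (_ | i) hi f
      · exact absurd hi (by decide)
      -- `ExtZero i` is the vanishing of 𝔼ⁱ⁺¹, which matches ⟨i + 1⟩: once 𝔼(A, B⟨i⟩) = 0, every map
      -- A → B⟨i + 1⟩ lifts to the hull of B⟨i⟩, an object of `W`.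
      have horth : X.Orth A.as (σ.shiftN i B).as :=
        hX.orth_isCosyzygy_of_extZero hF.1 (hS.ext_zero A.as B.as hA hB i) (hcosyz i B)
      have e : σ.shiftN (i + 1) B = σ.shift (σ.shiftN i B) := Function.iterate_succ_apply' _ _ _
      revert f
      rw [e]
      intro f
      obtain ⟨f, rfl⟩ := (stableFunctor W).map_surjective (X := A.as)
        (Y := σ.obj (σ.shiftN i B).as) f
      obtain ⟨g, rfl⟩ := hX.exists_lift (σ.real _) f (horth _)
      exact stableFunctor_map_eq_zero
        (AddSubgroup.subset_closure ⟨_, σ.hull_mem _, g, _, rfl⟩)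
    -- The hull of A is injective, so A → W_A extends over any inflation out of A; every 𝔼-triangle
    -- therefore yields a standard triangle.
    · have htri : ∀ {A B D : C}, X.IsTri A B D →
          σ.IsTri ((stableFunctor W).obj A) ((stableFunctor W).obj B)
            ((stableFunctor W).obj D) := by
        rintro A B D ⟨f, g, δ, ht⟩
        obtain ⟨m, hm⟩ := hWi _ (σ.hull_mem A) f g δ ht (σ.ι A)
        obtain ⟨h, hh, hδ⟩ := hX.et3 ht (σ.real A) (𝟙 A) m (by simpa using hm)
        rw [push_id] at hδ
        refine ⟨(stableFunctor W).map f, (stableFunctor W).map g, (stableFunctor W).map h,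
          _, _, _, (stableFunctor W).map f, (stableFunctor W).map g, (stableFunctor W).map h,
          Iso.refl _, Iso.refl _, Iso.refl _, 𝟙 _,
          ⟨f, g, δ, m, h, ht, hm, hh.symm, hδ, rfl, rfl, rfl⟩,
          ⟨𝟙 _, 𝟙 _, 𝟙 _, rfl, rfl, by simp, by simp, by simp⟩, ?_, ?_, ?_⟩
        · exact (Category.comp_id _).trans (Category.id_comp _).symm
        · exact (Category.comp_id _).trans (Category.id_comp _).symm
        · exact (Category.comp_id _).trans (Category.id_comp _).symm
      exact hsil.thick_eq A.as (P.inverseImage (stableFunctor W))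
        { toIsSubcat := hP.toIsSubcat.inverseImage_stableFunctor
          left := fun ht => hP.left (htri ht)
          middle := fun ht => hP.middle (htri ht)
          right := fun ht => hP.right (htri ht) } (fun B hB => hSP ⟨B⟩ hB)
  · refine fun hsil => ⟨hS, fun A P hP hSP => ?_⟩
    -- A thick P containing S contains `W`, so it is closed under stable isomorphism. This lets it
    -- absorb the isomorphisms in the definition of distinguished triangles.
    have hsub := hP.toIsSubcat.stableImage hC hW (hWS.trans hSP)
    have htri : ∀ {A B D : Stable W}, σ.IsTri A B D → ∃ A' B' D' : Stable W,
        Nonempty (A ≅ A') ∧ Nonempty (B ≅ B') ∧ Nonempty (D ≅ D') ∧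
          X.IsTri A'.as B'.as D'.as := by
      rintro A B D ⟨_, _, _, A', B', D', _, _, _, a, b, d, _, ⟨_, _, _, _, _, ht, -⟩, -⟩
      exact ⟨A', B', D', ⟨a⟩, ⟨b⟩, ⟨d⟩, ⟨_, _, _, ht⟩⟩
    refine hsil.thick_eq ⟨A⟩ (stableImage W P) 
      { toIsSubcat := hsub, left := ?_, middle := ?_, right := ?_ } (fun B hB => hSP _ hB)
    · intro A B D ht hB hD
      obtain ⟨A', B', D', ⟨a⟩, ⟨b⟩, ⟨d⟩, t⟩ := htri ht
      exact hsub.of_iso a.symm (hP.left t (hsub.of_iso b hB) (hsub.of_iso d hD))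
    · intro A B D ht hA hD
      obtain ⟨A', B', D', ⟨a⟩, ⟨b⟩, ⟨d⟩, t⟩ := htri ht
      exact hsub.of_iso b.symm (hP.middle t (hsub.of_iso a hA) (hsub.of_iso d hD))
    · intro A B D ht hA hB
      obtain ⟨A', B', D', ⟨a⟩, ⟨b⟩, ⟨d⟩, t⟩ := htri ht
      exact hsub.of_iso d.symm (hP.right t (hsub.of_iso a hA) (hsub.of_iso b hB))

end ExtStruct

end Extri

/-! ### Silting reduction -/

theorem proposition3p7 {k : Type*} [Field k] {C : Type*} [CategoryTheory.Category C]
    [CategoryTheory.Preadditive C] [CategoryTheory.Linear k C]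
    (hKS : Extri.IsKrullSchmidt C)
    (hfin : ∀ A B : C, FiniteDimensional k (A ⟶ B))
    (X : Extri.ExtStruct C) (hX : X.IsExtriangulated)
    (hproj : X.EnoughProj) (hinj : X.EnoughInj) (hWIC : X.WIC)
    (W : CategoryTheory.ObjectProperty C) (hW : X.IsPresilting W) (hCP : X.CP W)
    (S : CategoryTheory.ObjectProperty C) (hS : X.IsPresilting S) (hWS : W ≤ S) :
    -- `S` lies in `Z`
    S ≤ X.Z W ∧
    -- `Z` is a Frobenius extriangulated category with subcategory `W` of projective-injectives
    (X.restrict (X.Z W)).IsExtriangulated ∧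
    (X.restrict (X.Z W)).IsFrobenius ∧
    (X.restrict (X.Z W)).proj = W.inverseImage (X.Z W).ι ∧
    -- silting in `B` if and only if silting in `Z`
    (X.IsSilting S ↔ (X.restrict (X.Z W)).IsSilting (S.inverseImage (X.Z W).ι)) ∧
    -- silting in `B` if and only if `S/[W]` is silting in `Z/[W]`; the suspension exists, and
    -- the claim holds for every choice of it
    Nonempty (Extri.Suspension (X.restrict (X.Z W)) (W.inverseImage (X.Z W).ι)) ∧
    ∀ σ : Extri.Suspension (X.restrict (X.Z W)) (W.inverseImage (X.Z W).ι),
      X.IsSilting S ↔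
        σ.IsSilting (Extri.stableImage (W.inverseImage (X.Z W).ι)
          (S.inverseImage (X.Z W).ι)) := by
  have h : X.IsReductionDatum W :=
    ⟨hX, hproj, hinj, hX.retractsSplit hWIC, hW, hCP⟩
  have hsil := h.isSilting_iff hS hWS
  refine ⟨Extri.ExtStruct.le_Z hS hWS, h.isExtriangulated_Z, h.isFrobenius_Z, h.proj_Z, hsil,
    Extri.ExtStruct.nonempty_suspension fun A => ?_, fun σ => hsil.trans ?_⟩
  · obtain ⟨I, D, hI, ht⟩ := h.isFrobenius_Z.2.1 A
    exact ⟨I, D, (congrFun h.inj_Z _).mp hI, ht⟩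
  · exact Extri.ExtStruct.isSilting_stableImage_iff h.isExtriangulated_Z h.isFrobenius_Z
      (Extri.RetractsSplit.fullSubcategory h.retractsSplit h.isSubcat_Z) h.proj_Z
      hW.isSubcat.inverseImage_ι (h.isPresilting_Z hS hWS) (fun A hA => hWS _ hA) σ
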